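/- **Setting.** Let $M\subset\mathbb C^2$ be a real-analytic real hypersurface, given by a smooth real global defining function $\rho$: $\rho$ is defined on an open set $\Omega\subset\mathbb C^2$, $M=\{Z\in\Omega:\rho(Z)=0\}$ and $d\rho\neq0$ on $M$. With coordinates $Z=(z,w)$ put $$\bar L=-\rho_{\bar w}\,\partial_{\bar z}+\rho_{\bar z}\,\partial_{\bar w},\qquad \rho_{Z^2}(L,L)=\rho_{zz}\rho_w^2-2\rho_{zw}\rho_z\rho_w+\rho_{ww}\rho_z^2 ,$$ let $A_3(\rho)$ be the $5\times5$ matrix whose columns are $\bar L^j\big(\rho_w^3,\ \rho_z\rho_w^2,\ \rho_z^2\rho_w,\ \rho_z^3,\ \rho_{Z^2}(L,L)\big)^T$, $0\le j\le4$, and let $Q=\det A_3(\rho)$. The set of umbilical points of $M$ is $\mathcal U=\{p\in M: Q(p)=0\}$. Let $\mathcal U_1\subset\mathcal U$ be the set of $1$-regular umbilical points, i.e. of those points near which $\mathcal U$ is a smooth real curve (an embedded $1$-manifold). For a closed curve $C$ on which $R$ does not vanish, let $W_C(R)=\frac1{2\pi i}\int_C\frac{dR}{R}$ be the winding number. If an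 oriented surface $\Sigma\subset M$ meets $\mathcal U$ transversally (in $M$) at an interior point $p\in\mathcal U_1$, the local umbilical index is $$\iota_\Sigma(p)=-\tfrac12\,W_{\partial\Sigma_p}(Q),$$ where $\Sigma_p\subset\Sigma$ is any sufficiently small closed disk containing $p$ in its interior and $\partial\Sigma_p$ is oriented positively with respect to $\Sigma$. **Proposition 4.3.** Assume that $\mathcal U$ has no points of dimension $2$ or $3$; that is, for every $p\in\mathcal U$, every nonsingular part of $\mathcal U$ that has $p$ in its closure has dimension at most $1$. Let $\gamma\subset M$ be an oriented smooth closed curve that does not meet $\mathcal U$ and bounds in $M$ (so that it is homologous to $0$ in $M$): $\gamma=\partial\Sigma$ as oriented boundary, where $\Sigma\subset M$ is a compact oriented smooth embedded surface with boundary. Suppose that every point of $\mathcal U\cap\Sigma$ lies in $\mathcal U_1$ and that $\Sigma$ and $\mathcal U$ intersect transversally in $M$ there. Then $\mathcal U_1\cap\Sigma$ is finite, the indices $\iota_\Sigma(p)$ are well defined at its points, and $$W_\gamma(Q)=-2\sum_{p\in\mathcal U_1\cap\Sigma}\iota_\Sigma(p).$$ Equivalently, the umbilical index $-\frac12W_\gamma(Q)$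 of $\gamma$ is the sum of the local umbilical indices. -/

import Mathlib

open scoped ContDiff

noncomputable section

/-! ### Wirtinger derivatives on `ℂ²` with coordinates `Z = (z, w)` -/

/-- `∂f/∂z`. -/
def dz (f : ℂ × ℂ → ℂ) (Z : ℂ × ℂ) : ℂ :=
  (1 / 2) * (fderiv ℝ f Z (1, 0) - Complex.I * fderiv ℝ f Z (Complex.I, 0))

/-- `∂f/∂w`. -/
def dw (f : ℂ × ℂ → ℂ) (Z : ℂ × ℂ) : ℂ :=
  (1 / 2) * (fderiv ℝ f Z (0, 1) - Complex.I * fderiv ℝ f Z (0, Complex.I))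

/-- `∂f/∂z̄`. -/
def dzbar (f : ℂ × ℂ → ℂ) (Z : ℂ × ℂ) : ℂ :=
  (1 / 2) * (fderiv ℝ f Z (1, 0) + Complex.I * fderiv ℝ f Z (Complex.I, 0))

/-- `∂f/∂w̄`. -/
def dwbar (f : ℂ × ℂ → ℂ) (Z : ℂ × ℂ) : ℂ :=
  (1 / 2) * (fderiv ℝ f Z (0, 1) + Complex.I * fderiv ℝ f Z (0, Complex.I))

/-! ### The invariant determinant -/

/-- A real function regarded as a complex-valued one. -/
def toCplx (ρ : ℂ × ℂ → ℝ) (Z : ℂ × ℂ) : ℂ := (ρ Z : ℂ)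

/-- `ρ_z`. -/
def rhoz (ρ : ℂ × ℂ → ℝ) : ℂ × ℂ → ℂ := dz (toCplx ρ)

/-- `ρ_w`. -/
def rhow (ρ : ℂ × ℂ → ℝ) : ℂ × ℂ → ℂ := dw (toCplx ρ)

/-- The `(0,1)` vector field `L̄ = -ρ_w̄ ∂_z̄ + ρ_z̄ ∂_w̄`, conjugate to
`L = -ρ_w ∂_z + ρ_z ∂_w`, acting on complex-valued functions. -/
def Lbar (ρ : ℂ × ℂ → ℝ) (f : ℂ × ℂ → ℂ) (Z : ℂ × ℂ) : ℂ :=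
  -(dwbar (toCplx ρ) Z) * dzbar f Z + dzbar (toCplx ρ) Z * dwbar f Z

/-- The holomorphic Hessian evaluated at `(L, L)`:
`ρ_zz ρ_w² - 2 ρ_zw ρ_z ρ_w + ρ_ww ρ_z²`. -/
def hessLL (ρ : ℂ × ℂ → ℝ) (Z : ℂ × ℂ) : ℂ :=
  dz (rhoz ρ) Z * rhow ρ Z ^ 2 - 2 * dz (rhow ρ) Z * rhoz ρ Z * rhow ρ Z
    + dw (rhow ρ) Z * rhoz ρ Z ^ 2

/-- The first column of `A₃`: the cubic monomials in `(ρ_z, ρ_w)` followed by `ρ_{Z²}(L, L)`. -/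
def colA3 (ρ : ℂ × ℂ → ℝ) : Fin 5 → ℂ × ℂ → ℂ :=
  ![fun Z => rhow ρ Z ^ 3,
    fun Z => rhoz ρ Z * rhow ρ Z ^ 2,
    fun Z => rhoz ρ Z ^ 2 * rhow ρ Z,
    fun Z => rhoz ρ Z ^ 3,
    hessLL ρ]

/-- The `5 × 5` matrix `A₃(ρ)`: its `j`-th column, `0 ≤ j ≤ 4`, is `L̄^j` of the first column. -/
def A3 (ρ : ℂ × ℂ → ℝ) (Z : ℂ × ℂ) : Matrix (Fin 5) (Fin 5) ℂ :=
  Matrix.of fun i j => ((Lbar ρ)^[(j : ℕ)] (colA3 ρ i)) Z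

/-- `Q = det A₃(ρ)`. -/
def umbilicalDet (ρ : ℂ × ℂ → ℝ) (Z : ℂ × ℂ) : ℂ := (A3 ρ Z).det

/-! ### Submanifolds, hypersurfaces, dimension of a variety -/

/-- Near its point `p`, the subset `S` of `ℂ²` is an embedded real submanifold of class `C^n` and
of real dimension `d` (`n = ∞`: smooth, `n = ω`: real-analytic). -/
def IsSubmanifoldAt (n : WithTop ℕ∞) (d : ℕ) (S : Set (ℂ × ℂ)) (p : ℂ × ℂ) : Prop :=
  p ∈ S ∧ ∃ c : ℕ, d + c = 4 ∧ ∃ (V : Set (ℂ × ℂ)) (g : ℂ × ℂ → Fin c → ℝ),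
    IsOpen V ∧ p ∈ V ∧ ContDiffOn ℝ n g V ∧
    (∀ x ∈ V, Function.Surjective (fderiv ℝ g x)) ∧
    S ∩ V = {x ∈ V | g x = 0}

/-- `M` is a real-analytic real hypersurface of `ℂ²`. -/
def IsRealAnalyticHypersurface (M : Set (ℂ × ℂ)) : Prop :=
  ∀ p ∈ M, IsSubmanifoldAt ω 3 M p

/-- `ρ` is a (smooth, real) global defining function of `M`, defined on the open set `Ω`. -/
structure IsDefiningFunction (ρ : ℂ × ℂ → ℝ) (Ω M : Set (ℂ × ℂ)) : Prop where
  isOpen : IsOpen Ω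
  contDiffOn : ContDiffOn ℝ ∞ ρ Ω
  eq_zeroSet : M = {Z ∈ Ω | ρ Z = 0}
  fderiv_ne_zero : ∀ Z ∈ M, fderiv ℝ ρ Z ≠ 0

/-- The dimension at `p` of a real-analytic subvariety `S`: the largest dimension of a nonsingular
part of `S` with `p` in its closure. (All `d` that occur are at most `4`.) -/
def varietyDimAt (S : Set (ℂ × ℂ)) (p : ℂ × ℂ) : ℕ :=
  sSup {d : ℕ | p ∈ closure {q | IsSubmanifoldAt ω d S q}}

/-- The set `𝒰` of umbilical points of `M = {ρ = 0}`: the zero set of `Q` on `M`. -/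
def umbilicalSet (ρ : ℂ × ℂ → ℝ) (M : Set (ℂ × ℂ)) : Set (ℂ × ℂ) :=
  {p ∈ M | umbilicalDet ρ p = 0}

/-- The set `𝒰₁` of `1`-regular umbilical points: those near which `𝒰` is a smooth real curve. -/
def regularUmbilicalSet (ρ : ℂ × ℂ → ℝ) (M : Set (ℂ × ℂ)) : Set (ℂ × ℂ) :=
  {p | IsSubmanifoldAt ∞ 1 (umbilicalSet ρ M) p}

/-- The tangent space of a set at a point (for a submanifold, with or without boundary, this is
its usual tangent space). -/
def tangentSpan (S : Set (ℂ × ℂ)) (p : ℂ × ℂ) : Submodule ℝ (ℂ × ℂ) :=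
  Submodule.span ℝ (tangentConeAt ℝ S p)

/-! ### Compact oriented surfaces with boundary

The parameter plane `ℝ²` is identified with `ℂ`, with its standard orientation; the closed upper
half plane is `{x | 0 ≤ x.im}`. -/

/-- `φ`, restricted to `O ∩ {im ≥ 0}`, is a smooth local parametrization of the embedded surface
with boundary `S`: a smooth immersion of the open set `O`, whose restriction to `O ∩ {im ≥ 0}` is a
homeomorphism onto a relatively open subset of `S`. -/
structure IsLocalParam (S : Set (ℂ × ℂ)) (O : Set ℂ) (φ : ℂ → ℂ × ℂ) : Prop where
  isOpen : IsOpen O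
  contDiffOn : ContDiffOn ℝ ∞ φ O
  immersion : ∀ x ∈ O, Function.Injective (fderiv ℝ φ x)
  injOn : Set.InjOn φ (O ∩ {x | 0 ≤ x.im})
  image_open : ∀ V : Set ℂ, IsOpen V → V ⊆ O →
    ∃ W : Set (ℂ × ℂ), IsOpen W ∧ φ '' (V ∩ {x | 0 ≤ x.im}) = S ∩ W

/-- Two local parametrizations induce the same orientation: wherever they meet, the Jacobian
determinant of the change of parameters is positive. -/
def SameOrientation (O : Set ℂ) (φ : ℂ → ℂ × ℂ) (O' : Set ℂ) (ψ : ℂ → ℂ × ℂ) : Prop :=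
  ∀ x ∈ O, ∀ y ∈ O', 0 ≤ x.im → 0 ≤ y.im → φ x = ψ y →
    ∃ A : ℂ →L[ℝ] ℂ, 0 < LinearMap.det (A : ℂ →ₗ[ℝ] ℂ) ∧
      fderiv ℝ φ x = (fderiv ℝ ψ y).comp A

/-- A compact oriented smooth embedded surface with (possibly empty) boundary in `ℂ²`, given by
an oriented atlas of local parametrizations. -/
structure OrientedSurface where
  carrier : Set (ℂ × ℂ)
  isCompact : IsCompact carrier
  atlas : Set (Set ℂ × (ℂ → ℂ × ℂ))
  isLocalParam : ∀ c ∈ atlas, IsLocalParam carrier c.1 c.2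
  covers : ∀ p ∈ carrier, ∃ c ∈ atlas, ∃ x ∈ c.1, 0 ≤ x.im ∧ c.2 x = p
  sameOrientation : ∀ c ∈ atlas, ∀ c' ∈ atlas, SameOrientation c.1 c.2 c'.1 c'.2

/-- Positively oriented local parametrizations of an oriented surface. -/
def OrientedSurface.IsPositiveParam (S : OrientedSurface) (O : Set ℂ) (φ : ℂ → ℂ × ℂ) : Prop :=
  IsLocalParam S.carrier O φ ∧ ∀ c ∈ S.atlas, SameOrientation O φ c.1 c.2

/-- The boundary `∂Σ`. -/
def OrientedSurface.boundary (S : OrientedSurface) : Set (ℂ × ℂ) :=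
  {p | ∃ c ∈ S.atlas, ∃ x ∈ c.1, x.im = 0 ∧ c.2 x = p}

/-- The smooth closed curve `γ` (a `2π`-periodic map, one period being traversed once) is the
oriented boundary of `Σ`: it parametrizes `∂Σ` injectively, in the direction that corresponds, in
positively oriented parameters from the upper half plane, to the positive direction of the real
axis (so that `Σ` lies to the left of `γ`). -/
structure OrientedSurface.IsOrientedBoundary (S : OrientedSurface) (γ : ℝ → ℂ × ℂ) : Prop where
  contDiff : ContDiff ℝ ∞ γ
  periodic : Function.Periodic γ (2 * Real.pi)
  injOn : Set.InjOn γ (Set.Ico 0 (2 * Real.pi))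
  range_eq : Set.range γ = S.boundary
  direction : ∀ t : ℝ, ∀ c ∈ S.atlas, ∀ x ∈ c.1, x.im = 0 → c.2 x = γ t →
    ∃ k : ℝ, 0 < k ∧ deriv γ t = k • fderiv ℝ c.2 x 1

/-! ### Winding numbers and umbilical indices -/

/-- The winding number `(1 / 2πi) ∫_γ dR / R` of `R` along a closed curve `γ` that is parametrized
over `[0, 2π]`. -/
def windingNumber (R : ℂ × ℂ → ℂ) (γ : ℝ → ℂ × ℂ) : ℂ :=
  (2 * Real.pi * Complex.I)⁻¹ *
    ∫ t in (0 : ℝ)..(2 * Real.pi), deriv (fun s => R (γ s)) t / R (γ t)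

/-- `ι` is the index of `Q` at `p` with respect to the oriented surface `Σ`: it is `-1/2` times the
winding number of `Q` along the positively oriented boundary of any sufficiently small (smooth,
closed) disk in `Σ` that contains `p` in its interior. -/
def IsLocalIndex (Q : ℂ × ℂ → ℂ) (S : OrientedSurface) (p : ℂ × ℂ) (ι : ℂ) : Prop :=
  ∃ W : Set (ℂ × ℂ), IsOpen W ∧ p ∈ W ∧
    ∀ (O : Set ℂ) (φ : ℂ → ℂ × ℂ) (c : ℂ) (r : ℝ), S.IsPositiveParam O φ → 0 < r →
      Metric.closedBall c r ⊆ O ∩ {x | 0 < x.im} → p ∈ φ '' Metric.ball c r →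
      φ '' Metric.closedBall c r ⊆ W →
      ι = -(1 / 2) * windingNumber Q (fun t => φ (circleMap c r t))

open Classical in
/-- The local umbilical index `ι_Σ(p)` (the value is meaningful when `IsLocalIndex` holds for some
`ι`, which is then unique at an interior point `p` of `Σ`). -/
def localIndex (Q : ℂ × ℂ → ℂ) (S : OrientedSurface) (p : ℂ × ℂ) : ℂ :=
  if h : ∃ ι, IsLocalIndex Q S p ι then h.choose else 0

end

/-!
The formula is the argument principle on a compact oriented surface with boundary, and holds for
every smooth complex function `q` on a neighbourhood of the surface which has finitely many zeros
on it, none of them on the boundary.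

Away from its zeros, `dq / q` is a closed `1`-form. Let `cutoffInv ε` be a smooth function on `ℂ`
that equals `u ↦ u⁻¹` for `‖u‖ ≥ ε`, where `ε` is smaller than `‖q‖` on the boundary and outside
small disks around the zeros. Then `cutoffInv ε (q) dq` is a globally smooth form. It agrees with
`dq / q` on the boundary curve and on the boundary circles of the disks, and its differential
`d(cutoffInv ε (q)) ∧ dq` vanishes outside the disks (`wedge_fderiv_cutoffInv_eq_zero`). By
Stokes' theorem on the surface
(`OrientedSurface.IsOrientedBoundary.integral_mul_fderiv_eq_surfInt`) the winding number along the
boundary is the integral of this differential over the surface; by Stokes' theorem on a disk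
(`integral_ball_wedge`) its integral over each disk is the winding number along the boundary of
that disk.

The integral of a `2`-form over the surface (`PatchSystem.surfInt`) is defined by a partition of
unity subordinate to coordinate half disks. That a form supported in one coordinate domain may be
integrated there is the change of variables formula `setIntegral_pullWedge_eq`, which is also the
reason why the local index does not depend on the disk (`windingNumber_disk_eq`). Forms in the
ambient space `ℂ²` are used throughout, so no calculus on the surface itself is needed.

Transversality enters only through `IsLocalParam.eventually_eq_of_transversal`: a dimension count
shows that umbilical points on the surface are isolated, hence finite in number by compactness.
-/

section
open Set Filter Topology MeasureTheory

/-! ### Local parametrizations -/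

/-- The closed upper half plane of parameters. -/
def upperPlane : Set ℂ := {x | 0 ≤ x.im}

theorem isClosed_upperPlane : IsClosed upperPlane :=
  isClosed_le continuous_const Complex.continuous_im

/-- A smooth immersion has a local left inverse that is defined and `C¹` on a whole neighbourhood
of the image point in the ambient space: project linearly onto the tangent plane, then invert. -/
theorem exists_local_leftInverse {φ : ℂ → ℂ × ℂ} {x₀ : ℂ} (hφ : ContDiffAt ℝ ∞ φ x₀)
    (hinj : Function.Injective (fderiv ℝ φ x₀)) :
    ∃ l : ℂ × ℂ → ℂ, (∀ᶠ x in 𝓝 x₀, l (φ x) = x) ∧ ∀ᶠ z in 𝓝 (φ x₀), ContDiffAt ℝ 1 l z := by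
  obtain ⟨P, hP⟩ := LinearMap.exists_leftInverse_of_injective
    (fderiv ℝ φ x₀ : ℂ →ₗ[ℝ] ℂ × ℂ) (LinearMap.ker_eq_bot.2 hinj)
  let P' : ℂ × ℂ →L[ℝ] ℂ := LinearMap.toContinuousLinearMap P
  have hφ1 : ContDiffAt ℝ 1 φ x₀ := hφ.of_le (by exact_mod_cast le_top)
  have hc : ContDiffAt ℝ 1 (fun x => P' (φ x)) x₀ := P'.contDiff.contDiffAt.comp x₀ hφ1
  have hd : HasFDerivAt (fun x => P' (φ x))
      ((ContinuousLinearEquiv.refl ℝ ℂ : ℂ ≃L[ℝ] ℂ) : ℂ →L[ℝ] ℂ) x₀ := by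
    have h := P'.hasFDerivAt.comp x₀ (hφ1.differentiableAt one_ne_zero).hasFDerivAt
    refine h.congr_fderiv (ContinuousLinearMap.ext fun v => ?_)
    exact LinearMap.congr_fun hP v
  refine ⟨fun z => hc.localInverse hd one_ne_zero (P' z), ?_, ?_⟩
  · exact (hc.hasStrictFDerivAt' hd one_ne_zero).eventually_left_inverse
  · have h1 : ContDiffAt ℝ 1 (fun z => hc.localInverse hd one_ne_zero (P' z)) (φ x₀) :=
      (hc.to_localInverse hd one_ne_zero).comp (φ x₀) P'.contDiff.contDiffAt
    exact h1.eventually (by simp)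

namespace IsLocalParam

variable {S : Set (ℂ × ℂ)} {O O' : Set ℂ} {φ ψ : ℂ → ℂ × ℂ}

theorem contDiffAt (h : IsLocalParam S O φ) {x : ℂ} (hx : x ∈ O) : ContDiffAt ℝ ∞ φ x :=
  h.contDiffOn.contDiffAt (h.isOpen.mem_nhds hx)

theorem differentiableAt (h : IsLocalParam S O φ) {x : ℂ} (hx : x ∈ O) :
    DifferentiableAt ℝ φ x :=
  (h.contDiffAt hx).differentiableAt (by simp)

theorem mem (h : IsLocalParam S O φ) {x : ℂ} (hx : x ∈ O) (hi : 0 ≤ x.im) : φ x ∈ S := by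
  obtain ⟨W, -, hW⟩ := h.image_open O h.isOpen subset_rfl
  exact (hW.subset ⟨x, ⟨hx, hi⟩, rfl⟩).1

/-- A neighbourhood of `x` in the half plane covers a neighbourhood of `φ x` in the surface. -/
theorem eventually_mem_image (h : IsLocalParam S O φ) {x : ℂ} (hx : x ∈ O) (hi : 0 ≤ x.im)
    {V : Set ℂ} (hV : V ∈ 𝓝 x) :
    ∀ᶠ z in 𝓝[S] (φ x), ∃ y ∈ V ∩ O, 0 ≤ y.im ∧ φ y = z := by
  obtain ⟨V', hV', hV'o, hxV'⟩ := mem_nhds_iff.1 (inter_mem hV (h.isOpen.mem_nhds hx))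
  obtain ⟨W, hW, hWe⟩ := h.image_open V' hV'o (fun y hy => (hV' hy).2)
  have hxW : φ x ∈ W := (hWe.subset ⟨x, ⟨hxV', hi⟩, rfl⟩).2
  filter_upwards [mem_nhdsWithin_of_mem_nhds (hW.mem_nhds hxW), self_mem_nhdsWithin] with z hz hzS
  obtain ⟨y, ⟨hy, hyi⟩, rfl⟩ := hWe.superset ⟨hzS, hz⟩
  exact ⟨y, hV' hy, hyi, rfl⟩

/-- If `l` is a local left inverse of `ψ`, then `l ∘ φ` agrees near `x` with the change of
parameters, and its derivative at `x` is the matrix `A` of the change of orientation. -/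
theorem hasFDerivAt_leftInverse_comp (h : IsLocalParam S O φ) (h' : IsLocalParam S O' ψ)
    {x y : ℂ} (hx : x ∈ O) (hy : y ∈ O') (hxy : φ x = ψ y)
    {A : ℂ →L[ℝ] ℂ} (hA : fderiv ℝ φ x = (fderiv ℝ ψ y).comp A)
    {l : ℂ × ℂ → ℂ} (hl : ∀ᶠ u in 𝓝 y, l (ψ u) = u) (hl' : DifferentiableAt ℝ l (ψ y)) :
    HasFDerivAt (fun u => l (φ u)) A x := by
  have hid : (fderiv ℝ l (ψ y)).comp (fderiv ℝ ψ y) = ContinuousLinearMap.id ℝ ℂ := by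
    have h1 := hl'.hasFDerivAt.comp y (h'.differentiableAt hy).hasFDerivAt
    exact h1.unique ((hasFDerivAt_id y).congr_of_eventuallyEq hl)
  have h2 := (hxy ▸ hl'.hasFDerivAt : HasFDerivAt l (fderiv ℝ l (ψ y)) (φ x)).comp x
    (h.differentiableAt hx).hasFDerivAt
  rwa [hA, ← ContinuousLinearMap.comp_assoc, hid, ContinuousLinearMap.id_comp] at h2

/-- Interior points are not boundary points: otherwise the imaginary part of the change of
parameters would have a local minimum at an interior point, where its derivative is onto. -/
theorem im_pos_of_im_pos (h : IsLocalParam S O φ) (h' : IsLocalParam S O' ψ)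
    (hor : SameOrientation O' ψ O φ) {x y : ℂ} (hx : x ∈ O) (hy : y ∈ O') (hxi : 0 ≤ x.im)
    (hyi : 0 < y.im) (hxy : φ x = ψ y) : 0 < x.im := by
  by_contra hcon
  have hx0 : x.im = 0 := le_antisymm (not_lt.1 hcon) hxi
  obtain ⟨A, hAd, hA⟩ := hor y hy x hx hyi.le hxi hxy.symm
  obtain ⟨l, hl, hl'⟩ := exists_local_leftInverse (h.contDiffAt hx) (h.immersion x hx)
  have hd := h'.hasFDerivAt_leftInverse_comp h hy hx hxy.symm hA hl
    (hl'.self_of_nhds.differentiableAt one_ne_zero)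
  have hd2 := (Complex.imCLM.hasFDerivAt).comp y hd
  have hlx : l (ψ y) = x := hxy ▸ hl.self_of_nhds
  have hmin : IsLocalMin (fun u => Complex.imCLM (l (ψ u))) y := by
    have hc : Tendsto ψ (𝓝 y) (𝓝 (φ x)) := hxy ▸ (h'.differentiableAt hy).continuousAt
    have hin : ∀ᶠ u in 𝓝 y, u ∈ O' ∧ 0 ≤ u.im :=
      (show ∀ᶠ u in 𝓝 y, u ∈ O' from h'.isOpen.mem_nhds hy).and
        ((Complex.continuous_im.continuousAt.eventually (lt_mem_nhds hyi)).mono fun _ h => h.le)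
    have hc' : Tendsto ψ (𝓝 y) (𝓝[S] (φ x)) :=
      tendsto_nhdsWithin_iff.2 ⟨hc, hin.mono fun u hu => h'.mem hu.1 hu.2⟩
    filter_upwards [hc'.eventually (h.eventually_mem_image hx hxi hl)] with u hu
    obtain ⟨v, ⟨hv, -⟩, hvi, hvu⟩ := hu
    simp only [Complex.imCLM_apply, hlx, hx0, ← hvu]
    rw [show l (φ v) = v from hv]
    exact hvi
  have hz := hmin.hasFDerivAt_eq_zero hd2
  have hsurj : Function.Surjective (A : ℂ →ₗ[ℝ] ℂ) := by
    exact ((Module.End.isUnit_iff _).1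
      ((LinearMap.isUnit_iff_isUnit_det _).2 hAd.ne'.isUnit)).2
  obtain ⟨v, hv⟩ := hsurj Complex.I
  have := DFunLike.congr_fun hz v
  simp at this
  rw [show A v = Complex.I from hv] at this
  simp at this

theorem measurableSet_image (h : IsLocalParam S O φ) {E : Set ℂ} (hE : MeasurableSet E)
    (hEO : E ⊆ O ∩ upperPlane) : MeasurableSet (φ '' E) :=
  hE.image_of_continuousOn_injOn
    (fun _ hx => (h.differentiableAt (hEO hx).1).continuousAt.continuousWithinAt)
    (h.injOn.mono hEO)

theorem measurableSet_inter_preimage (h : IsLocalParam S O φ) {E : Set ℂ} (hE : MeasurableSet E)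
    (hEO : E ⊆ O) {T : Set (ℂ × ℂ)} (hT : MeasurableSet T) : MeasurableSet (E ∩ φ ⁻¹' T) := by
  have hc : ContinuousOn φ E :=
    fun _ hx => (h.differentiableAt (hEO hx)).continuousAt.continuousWithinAt
  have := hE.subtype_image ((continuousOn_iff_continuous_domRestrict.1 hc).measurable hT)
  convert this using 1
  ext x
  simp [and_comm]

end IsLocalParam

/-! ### Change of variables for wedge products of `1`-forms -/

/-- The value at `(u, v)` of the wedge product of two covectors. -/
noncomputable def wedge {E : Type*} [NormedAddCommGroup E] [NormedSpace ℝ E]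
    (a b : E →L[ℝ] ℂ) (u v : E) : ℂ := a u * b v - a v * b u

/-- The density with respect to `dx dy` of the pullback by `φ` of the `2`-form `α ∧ β`. -/
noncomputable def pullWedge (α β : ℂ × ℂ → ℂ × ℂ →L[ℝ] ℂ) (φ : ℂ → ℂ × ℂ) (x : ℂ) : ℂ :=
  wedge (α (φ x)) (β (φ x)) (fderiv ℝ φ x 1) (fderiv ℝ φ x Complex.I)

theorem Complex.det_eq_re_im (A : ℂ →L[ℝ] ℂ) :
    LinearMap.det (A : ℂ →ₗ[ℝ] ℂ) = (A 1).re * (A Complex.I).im - (A Complex.I).re * (A 1).im := by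
  rw [← LinearMap.det_toMatrix Complex.basisOneI, Matrix.det_fin_two]
  simp [LinearMap.toMatrix_apply]

theorem wedge_comp {E : Type*} [NormedAddCommGroup E] [NormedSpace ℝ E]
    (a b : E →L[ℝ] ℂ) (D : ℂ →L[ℝ] E) (A : ℂ →L[ℝ] ℂ) :
    wedge a b (D (A 1)) (D (A Complex.I)) =
      ((LinearMap.det (A : ℂ →ₗ[ℝ] ℂ) : ℝ) : ℂ) * wedge a b (D 1) (D Complex.I) := by
  have hdec : ∀ u : ℂ, D u = u.re • D 1 + u.im • D Complex.I := fun u => by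
    conv_lhs => rw [← Complex.re_add_im u]
    rw [← map_smul, ← map_smul, ← map_add]
    simp
  rw [hdec (A 1), hdec (A Complex.I), Complex.det_eq_re_im]
  simp only [wedge, map_add, map_smul, Complex.real_smul]
  push_cast
  ring

/-- Change of variables: if `α ∧ β` vanishes at the points of the symmetric difference of `φ(E)`
and `ψ(E')`, its integrals over `E` and `E'` in the two parametrizations agree. -/
theorem setIntegral_pullWedge_eq {S : Set (ℂ × ℂ)} {O O' : Set ℂ} {φ ψ : ℂ → ℂ × ℂ}
    (h : IsLocalParam S O φ) (h' : IsLocalParam S O' ψ) (hor : SameOrientation O φ O' ψ)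
    {E E' : Set ℂ} (hE : MeasurableSet E) (hE' : MeasurableSet E')
    (hEO : E ⊆ O ∩ upperPlane) (hEO' : E' ⊆ O' ∩ upperPlane)
    {α β : ℂ × ℂ → ℂ × ℂ →L[ℝ] ℂ}
    (h0 : ∀ x ∈ E, φ x ∉ ψ '' E' → ∀ u v, wedge (α (φ x)) (β (φ x)) u v = 0)
    (h0' : ∀ y ∈ E', ψ y ∉ φ '' E → ∀ u v, wedge (α (ψ y)) (β (ψ y)) u v = 0) :
    ∫ x in E, pullWedge α β φ x = ∫ y in E', pullWedge α β ψ y := by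
  -- `A` and `B` are the two parameter domains of `φ(E) ∩ ψ(E')`, with transition map `τ`
  set A := E ∩ φ ⁻¹' (ψ '' E') with hAdef
  set B := E' ∩ ψ ⁻¹' (φ '' E) with hBdef
  have hA : MeasurableSet A := h.measurableSet_inter_preimage hE (fun x hx => (hEO hx).1)
    (h'.measurableSet_image hE' hEO')
  have hE1 : ∫ x in E, pullWedge α β φ x = ∫ x in A, pullWedge α β φ x :=
    setIntegral_eq_of_subset_of_forall_sdiff_eq_zero hE inter_subset_left
      (fun x hx => h0 x hx.1 (fun hx' => hx.2 ⟨hx.1, hx'⟩) _ _)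
  have hE2 : ∫ y in E', pullWedge α β ψ y = ∫ y in B, pullWedge α β ψ y :=
    setIntegral_eq_of_subset_of_forall_sdiff_eq_zero hE' inter_subset_left
      (fun x hx => h0' x hx.1 (fun hx' => hx.2 ⟨hx.1, hx'⟩) _ _)
  let τ : ℂ → ℂ := fun x => Function.invFunOn ψ (O' ∩ upperPlane) (φ x)
  have hτ : ∀ x ∈ A, τ x ∈ E' ∧ ψ (τ x) = φ x := by
    rintro x ⟨hx, y, hy, hyx⟩
    have : τ x = y := by
      simp only [τ, ← hyx]
      exact h'.injOn.leftInvOn_invFunOn (hEO' hy)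
    rw [this]; exact ⟨hy, hyx⟩
  have hBA : B = τ '' A := by
    ext y
    constructor
    · rintro ⟨hy, x, hx, hxy⟩
      refine ⟨x, ⟨hx, y, hy, hxy.symm⟩, ?_⟩
      simp only [τ, hxy]
      exact h'.injOn.leftInvOn_invFunOn (hEO' hy)
    · rintro ⟨x, hx, rfl⟩
      exact ⟨(hτ x hx).1, x, hx.1, (hτ x hx).2.symm⟩
  have hτinj : InjOn τ A := by
    intro x hx x' hx' he
    apply h.injOn (hEO hx.1) (hEO hx'.1)
    rw [← (hτ x hx).2, ← (hτ x' hx').2, he]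
  have hex : ∀ x ∈ A, ∃ D : ℂ →L[ℝ] ℂ, 0 < LinearMap.det (D : ℂ →ₗ[ℝ] ℂ) ∧
      fderiv ℝ φ x = (fderiv ℝ ψ (τ x)).comp D := fun x hx =>
    hor x (hEO hx.1).1 (τ x) (hEO' (hτ x hx).1).1 (hEO hx.1).2 (hEO' (hτ x hx).1).2 (hτ x hx).2.symm
  choose! D hDpos hD using hex
  have hderiv : ∀ x ∈ A, HasFDerivWithinAt τ (D x) A x := by
    intro x hx
    have hy := hEO' (hτ x hx).1
    obtain ⟨l, hl, hl'⟩ := exists_local_leftInverse (h'.contDiffAt hy.1) (h'.immersion _ hy.1)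
    have hd := (h.hasFDerivAt_leftInverse_comp h' (hEO hx.1).1 hy.1 (hτ x hx).2.symm (hD x hx) hl
      (hl'.self_of_nhds.differentiableAt one_ne_zero)).hasFDerivWithinAt (s := A)
    refine hd.congr_of_eventuallyEq ?_ ?_
    · have hc : Tendsto φ (𝓝[A] x) (𝓝[S] (ψ (τ x))) := by
        rw [(hτ x hx).2]
        exact tendsto_nhdsWithin_iff.2
          ⟨(h.differentiableAt (hEO hx.1).1).continuousAt.continuousWithinAt,
          eventually_mem_nhdsWithin.mono fun u hu => h.mem (hEO hu.1).1 (hEO hu.1).2⟩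
      filter_upwards [hc.eventually (h'.eventually_mem_image hy.1 hy.2 hl),
        self_mem_nhdsWithin] with u hu huA
      obtain ⟨v, ⟨hv, hvO⟩, hvi, hvu⟩ := hu
      have : τ u = v := h'.injOn (hEO' (hτ u huA).1) ⟨hvO, hvi⟩ ((hτ u huA).2.trans hvu.symm)
      rw [this, ← hvu]
      exact (show l (ψ v) = v from hv).symm
    · rw [← (hτ x hx).2]; exact hl.self_of_nhds.symm
  rw [hE1, hE2, hBA, integral_image_eq_integral_abs_det_fderiv_smul volume hA hderiv hτinj]
  refine setIntegral_congr_fun hA fun x hx => ?_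
  have hdet : |(D x).det| = LinearMap.det (D x : ℂ →ₗ[ℝ] ℂ) := abs_of_pos (hDpos x hx)
  simp only [hdet, Complex.real_smul, pullWedge]
  rw [hD x hx, (hτ x hx).2, ← wedge_comp]
  rfl

/-! ### Stokes' theorem for the form `f dq` in the plane -/

/-- The exterior derivative of `f dq` is `df ∧ dq`. -/
theorem fderiv_mul_fderiv_sub {f q : ℂ → ℂ} {x : ℂ} (hf : DifferentiableAt ℝ f x)
    (hq : ContDiffAt ℝ 2 q x) (u v : ℂ) :
    fderiv ℝ (fun y => f y * fderiv ℝ q y v) x u - fderiv ℝ (fun y => f y * fderiv ℝ q y u) x v =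
      wedge (fderiv ℝ f x) (fderiv ℝ q x) u v := by
  have hq' : DifferentiableAt ℝ (fderiv ℝ q) x :=
    (hq.fderiv_right (m := 1) (by norm_num)).differentiableAt one_ne_zero
  have hs : fderiv ℝ (fderiv ℝ q) x u v = fderiv ℝ (fderiv ℝ q) x v u :=
    (hq.isSymmSndFDerivAt (by simp)) u v
  have key : ∀ a b : ℂ, fderiv ℝ (fun y => f y * fderiv ℝ q y b) x a =
      f x * fderiv ℝ (fderiv ℝ q) x a b + fderiv ℝ f x a * fderiv ℝ q x b := fun a b => by
    have h1 : HasFDerivAt (fun y => fderiv ℝ q y b) _ x :=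
      hq'.hasFDerivAt.clm_apply (hasFDerivAt_const b x)
    refine (DFunLike.congr_fun (hf.hasFDerivAt.mul h1).fderiv a).trans ?_
    simp [mul_comm]
  rw [key, key, hs, wedge]
  ring

theorem contDiffAt_mul_fderiv {f q : ℂ → ℂ} {x : ℂ} (hf : ContDiffAt ℝ 1 f x)
    (hq : ContDiffAt ℝ 2 q x) (v : ℂ) : ContDiffAt ℝ 1 (fun y => f y * fderiv ℝ q y v) x :=
  hf.mul ((hq.fderiv_right (m := 1) (by norm_num)).clm_apply contDiffAt_const)

/-- Green's theorem for `P dx + R dy` on a rectangle. -/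
theorem integral_rect_fderiv_sub {P R : ℂ → ℂ} {a b : ℝ × ℝ} (hab : a ≤ b)
    (hP : ∀ p ∈ Icc a b, ContDiffAt ℝ 1 P (Complex.equivRealProdCLM.symm p))
    (hR : ∀ p ∈ Icc a b, ContDiffAt ℝ 1 R (Complex.equivRealProdCLM.symm p)) :
    ∫ p in Icc a b, (fderiv ℝ R (Complex.equivRealProdCLM.symm p) 1 -
        fderiv ℝ P (Complex.equivRealProdCLM.symm p) Complex.I) =
      (∫ s in a.1..b.1, P ⟨s, a.2⟩) - (∫ s in a.1..b.1, P ⟨s, b.2⟩) +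
        (∫ t in a.2..b.2, R ⟨b.1, t⟩) - ∫ t in a.2..b.2, R ⟨a.1, t⟩ := by
  set e : ℝ × ℝ →L[ℝ] ℂ := (Complex.equivRealProdCLM.symm : ℝ × ℝ →L[ℝ] ℂ) with he
  have hsub : Ioo a.1 b.1 ×ˢ Ioo a.2 b.2 ⊆ Icc a b := fun p hp =>
    ⟨⟨hp.1.1.le, hp.2.1.le⟩, ⟨hp.1.2.le, hp.2.2.le⟩⟩
  have hd : ∀ F : ℂ → ℂ, ∀ p, ContDiffAt ℝ 1 F (e p) →
      HasFDerivAt (fun p => F (e p)) ((fderiv ℝ F (e p)).comp e) p := fun F p h =>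
    (h.differentiableAt one_ne_zero).hasFDerivAt.comp p e.hasFDerivAt
  have hcF : ∀ F : ℂ → ℂ, (∀ p ∈ Icc a b, ContDiffAt ℝ 1 F (e p)) → ∀ v,
      ContinuousOn (fun p => fderiv ℝ F (e p) v) (Icc a b) := fun F h v p hp =>
    ((((h p hp).fderiv_right (m := 0) (by norm_num)).continuousAt.comp
      e.continuous.continuousAt).clm_apply continuousAt_const).continuousWithinAt
  have h1 : e (1, 0) = 1 := by apply Complex.ext <;> simp [he]
  have hI : e (0, 1) = Complex.I := by apply Complex.ext <;> simp [he]
  have hpt : ∀ s t : ℝ, e (s, t) = ⟨s, t⟩ := fun s t => rfl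
  have key := integral_divergence_prod_Icc_of_hasFDerivAt_of_le (fun p => R (e p))
    (fun p => -P (e p)) (fun p => (fderiv ℝ R (e p)).comp e) (fun p => -(fderiv ℝ P (e p)).comp e)
    a b hab (fun p hp => (hd R p (hR p hp)).continuousAt.continuousWithinAt)
    (fun p hp => (hd P p (hP p hp)).neg.continuousAt.continuousWithinAt)
    (fun p hp => hd R p (hR p (hsub hp))) (fun p hp => (hd P p (hP p (hsub hp))).neg)
    (by
      refine ContinuousOn.integrableOn_Icc ?_
      simp only [ContinuousLinearMap.comp_apply, neg_apply, h1, hI]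
      exact (hcF R hR 1).add (hcF P hP Complex.I).neg)
  simp only [ContinuousLinearMap.comp_apply, neg_apply, h1, hI, hpt,
    intervalIntegral.integral_neg] at key
  simp only [sub_eq_add_neg]
  refine key.trans ?_
  ring

/-- Stokes' theorem for `f dq` on a half disk, `f` vanishing near the circular part of the
boundary. The integral over the diameter is zero when the disk does not meet the real axis. -/
theorem integral_halfBall_wedge {f q : ℂ → ℂ} {x₀ : ℂ} {r : ℝ}
    (hf : ∀ x ∈ Metric.ball x₀ r, ContDiffAt ℝ 1 f x)
    (hq : ∀ x ∈ Metric.ball x₀ r, ContDiffAt ℝ 2 q x)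
    (hf0 : ∀ x ∈ Metric.ball x₀ r, r / 2 ≤ dist x x₀ → f x = 0) (hr : 0 < r) :
    ∫ x in Metric.ball x₀ r ∩ upperPlane, wedge (fderiv ℝ f x) (fderiv ℝ q x) 1 Complex.I =
      ∫ t in {t : ℝ | (t : ℂ) ∈ Metric.ball x₀ r}, f t * fderiv ℝ q t 1 := by
  classical
  set B := Metric.ball x₀ r with hB
  -- the components `P 1`, `P I` of `f dq`, extended by zero to the whole plane
  let P : ℂ → ℂ → ℂ := fun v => B.indicator fun x => f x * fderiv ℝ q x v
  have hPB : ∀ v, ∀ x ∈ B, P v =ᶠ[𝓝 x] fun x => f x * fderiv ℝ q x v := fun v x hx => by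
    filter_upwards [Metric.isOpen_ball.mem_nhds hx] with y hy
    exact indicator_of_mem hy _
  have hP0 : ∀ v, ∀ x ∉ B, P v =ᶠ[𝓝 x] fun _ => 0 := fun v x hx => by
    have : ∀ᶠ y in 𝓝 x, r / 2 < dist y x₀ := by
      apply (continuous_id.dist continuous_const).continuousAt.eventually
      apply lt_mem_nhds
      have : r ≤ dist x x₀ := not_lt.1 hx
      exact (half_lt_self hr).trans_le this
    filter_upwards [this] with y hy
    by_cases hyB : y ∈ B
    · simp only [P, indicator_of_mem hyB, hf0 y hyB hy.le, zero_mul]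
    · exact indicator_of_notMem hyB _
  have hPc : ∀ v x, ContDiffAt ℝ 1 (P v) x := fun v x => by
    by_cases hx : x ∈ B
    · exact (contDiffAt_mul_fderiv (hf x hx) (hq x hx) v).congr_of_eventuallyEq (hPB v x hx)
    · exact contDiffAt_const.congr_of_eventuallyEq (hP0 v x hx)
  let a : ℝ × ℝ := (x₀.re - r, 0)
  let b : ℝ × ℝ := (x₀.re + r, |x₀.im| + r)
  have hab : a ≤ b := ⟨by simp only [a, b]; linarith, by simp only [a, b]; positivity⟩
  have key := integral_rect_fderiv_sub (P := P 1) (R := P Complex.I) hab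
    (fun p _ => hPc 1 _) (fun p _ => hPc _ _)
  have hout : ∀ v, ∀ x ∉ B, P v x = 0 := fun v x hx => indicator_of_notMem hx _
  have hre : ∀ x ∈ B, |x.re - x₀.re| < r := fun x hx =>
    (Complex.abs_re_le_norm (x - x₀)).trans_lt (by rwa [← dist_eq_norm])
  have him : ∀ x ∈ B, |x.im - x₀.im| < r := fun x hx =>
    (Complex.abs_im_le_norm (x - x₀)).trans_lt (by rwa [← dist_eq_norm])
  have z1 : ∀ s : ℝ, P 1 ⟨s, b.2⟩ = 0 := fun s => hout _ _ fun h => by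
    have := (abs_lt.1 (him _ h)).2
    simp only [b] at this
    linarith [le_abs_self x₀.im]
  have z2 : ∀ t : ℝ, P Complex.I ⟨b.1, t⟩ = 0 := fun s => hout _ _ fun h => by
    have := (abs_lt.1 (hre _ h)).2
    simp only [b] at this
    linarith
  have z3 : ∀ t : ℝ, P Complex.I ⟨a.1, t⟩ = 0 := fun s => hout _ _ fun h => by
    have := (abs_lt.1 (hre _ h)).1
    simp only [a] at this
    linarith
  simp only [z1, z2, z3, intervalIntegral.integral_zero, sub_zero, add_zero] at key
  have hRHS : ∫ t in {t : ℝ | (t : ℂ) ∈ B}, f t * fderiv ℝ q t 1 =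
      ∫ s in a.1..b.1, P 1 ⟨s, a.2⟩ := by
    have hm : MeasurableSet {t : ℝ | (t : ℂ) ∈ B} :=
      (Metric.isOpen_ball.preimage Complex.continuous_ofReal).measurableSet
    have h1 : ∀ t : ℝ, P 1 ⟨t, a.2⟩ =
        {t : ℝ | (t : ℂ) ∈ B}.indicator (fun t : ℝ => f t * fderiv ℝ q t 1) t := fun t => by
      have ht : (⟨t, a.2⟩ : ℂ) = (t : ℂ) := rfl
      rw [ht]
      by_cases h : (t : ℂ) ∈ B
      · rw [indicator_of_mem (show t ∈ {t : ℝ | (t : ℂ) ∈ B} from h)]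
        exact indicator_of_mem h _
      · rw [indicator_of_notMem (show t ∉ {t : ℝ | (t : ℂ) ∈ B} from h)]
        exact indicator_of_notMem h _
    simp only [h1]
    rw [intervalIntegral.integral_of_le hab.1, setIntegral_indicator hm,
      inter_eq_self_of_subset_right]
    intro t ht
    have := abs_lt.1 (hre _ ht)
    simp only [Complex.ofReal_re] at this
    constructor <;> simp only [a, b] <;> linarith [this.1, this.2]
  rw [hRHS, ← key]
  have hmp := Complex.volume_preserving_equiv_real_prod.setIntegral_preimage_emb
    Complex.measurableEquivRealProd.measurableEmbedding
    (fun p => fderiv ℝ (P Complex.I) (Complex.equivRealProdCLM.symm p) 1 -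
        fderiv ℝ (P 1) (Complex.equivRealProdCLM.symm p) Complex.I) (Icc a b)
  rw [← hmp]
  have hmK : MeasurableSet (Complex.measurableEquivRealProd ⁻¹' Icc a b) :=
    Complex.measurableEquivRealProd.measurable measurableSet_Icc
  have hsub : B ∩ upperPlane ⊆ Complex.measurableEquivRealProd ⁻¹' Icc a b := by
    rintro x ⟨hx, hxi⟩
    have h1 := abs_lt.1 (hre _ hx)
    have h2 := abs_lt.1 (him _ hx)
    refine ⟨⟨?_, ?_⟩, ?_, ?_⟩ <;> simp only [a, b, Complex.measurableEquivRealProd_apply]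
    · linarith
    · exact hxi
    · linarith
    · linarith [le_abs_self x₀.im]
  have hbig : ∀ x : ℂ, Complex.equivRealProdCLM.symm (Complex.measurableEquivRealProd x) = x :=
    fun x => by apply Complex.ext <;> simp
  simp only [hbig]
  rw [setIntegral_eq_of_subset_of_forall_sdiff_eq_zero hmK hsub]
  · refine setIntegral_congr_fun (Metric.isOpen_ball.measurableSet.inter
      isClosed_upperPlane.measurableSet) fun x hx => ?_
    rw [(hPB _ x hx.1).fderiv_eq, (hPB _ x hx.1).fderiv_eq]
    exact (fderiv_mul_fderiv_sub ((hf x hx.1).differentiableAt one_ne_zero) (hq x hx.1) _ _).symm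
  · rintro x ⟨hxK, hx⟩
    have hxB : x ∉ B := fun h => hx ⟨h, hxK.1.2⟩
    rw [(hP0 _ x hxB).fderiv_eq, (hP0 _ x hxB).fderiv_eq]
    simp

/-- Polar coordinates centred at `c`, the radius and the angle being the real and the imaginary
part of the variable. -/
noncomputable def polarMap (c x : ℂ) : ℂ := c + x.re * Complex.exp (x.im * Complex.I)

theorem contDiff_polarMap (c : ℂ) : ContDiff ℝ ∞ (polarMap c) := by
  have h1 : ContDiff ℝ ∞ fun x : ℂ => ((x.re : ℝ) : ℂ) :=
    Complex.ofRealCLM.contDiff.comp Complex.reCLM.contDiff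
  have h2 : ContDiff ℝ ∞ fun x : ℂ => ((x.im : ℝ) : ℂ) :=
    Complex.ofRealCLM.contDiff.comp Complex.imCLM.contDiff
  exact contDiff_const.add (h1.mul ((h2.mul contDiff_const).cexp))

theorem fderiv_polarMap (c x v : ℂ) : fderiv ℝ (polarMap c) x v =
    v.re * Complex.exp (x.im * Complex.I) +
      x.re * (Complex.exp (x.im * Complex.I) * (v.im * Complex.I)) := by
  have h1 : HasFDerivAt (fun x : ℂ => ((x.re : ℝ) : ℂ))
      (Complex.ofRealCLM.comp Complex.reCLM) x := (Complex.ofRealCLM.comp Complex.reCLM).hasFDerivAt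
  have h2 : HasFDerivAt (fun x : ℂ => ((x.im : ℝ) : ℂ))
      (Complex.ofRealCLM.comp Complex.imCLM) x := (Complex.ofRealCLM.comp Complex.imCLM).hasFDerivAt
  have h3 := (h1.mul ((h2.mul_const Complex.I).cexp)).const_add c
  have h4 := h3.fderiv
  rw [show polarMap c = fun x : ℂ => c + ((x.re : ℝ) : ℂ) *
    Complex.exp ((x.im : ℝ) * Complex.I) from rfl]
  refine (DFunLike.congr_fun h4 v).trans ?_
  simp
  ring

theorem polarMap_add_two_pi (c x : ℂ) :
    polarMap c (x + (2 * Real.pi : ℝ) * Complex.I) = polarMap c x := by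
  simp only [polarMap]
  have : (((x + (2 * Real.pi : ℝ) * Complex.I).im : ℝ) : ℂ) * Complex.I =
      x.im * Complex.I + 2 * Real.pi * Complex.I := by simp; ring
  rw [this, Complex.exp_periodic]
  simp

/-- Stokes' theorem for `f dq` on a disk, by passing to polar coordinates. -/
theorem integral_ball_wedge {f q : ℂ → ℂ} {c : ℂ} {r : ℝ} (hr : 0 < r)
    (hf : ∀ x ∈ Metric.closedBall c r, ContDiffAt ℝ 1 f x)
    (hq : ∀ x ∈ Metric.closedBall c r, ContDiffAt ℝ 2 q x) :
    ∫ x in Metric.ball c r, wedge (fderiv ℝ f x) (fderiv ℝ q x) 1 Complex.I =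
      ∫ t in (0 : ℝ)..2 * Real.pi,
        f (circleMap c r t) * fderiv ℝ q (circleMap c r t) (deriv (circleMap c r) t) := by
  let a : ℝ × ℝ := (0, -Real.pi)
  let b : ℝ × ℝ := (r, Real.pi)
  have hab : a ≤ b := ⟨hr.le, by simp only [a, b]; linarith [Real.pi_pos]⟩
  let F : ℂ → ℂ := fun x => f (polarMap c x)
  let G : ℂ → ℂ := fun x => q (polarMap c x)
  have hin : ∀ x : ℂ, 0 ≤ x.re → x.re ≤ r → polarMap c x ∈ Metric.closedBall c r := by
    intro x h1 h2
    simp [polarMap, dist_eq_norm, Complex.norm_exp, abs_of_nonneg h1, h2]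
  have hin' : ∀ p ∈ Icc a b, polarMap c (Complex.equivRealProdCLM.symm p) ∈
      Metric.closedBall c r := fun p hp => hin _ hp.1.1 hp.2.1
  have hu : ∀ x, ContDiffAt ℝ ∞ (polarMap c) x := fun x => (contDiff_polarMap c).contDiffAt
  have hF : ∀ p ∈ Icc a b, ContDiffAt ℝ 1 F (Complex.equivRealProdCLM.symm p) := fun p hp =>
    (hf _ (hin' p hp)).comp _ ((hu _).of_le (by exact_mod_cast le_top))
  have hG : ∀ p ∈ Icc a b, ContDiffAt ℝ 2 G (Complex.equivRealProdCLM.symm p) := fun p hp =>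
    (hq _ (hin' p hp)).comp _ ((hu _).of_le (by norm_cast))
  have hGd : ∀ x : ℂ, 0 ≤ x.re → x.re ≤ r → ∀ v, fderiv ℝ G x v =
      fderiv ℝ q (polarMap c x) (fderiv ℝ (polarMap c) x v) := fun x h1 h2 v => by
    have := ((hq _ (hin x h1 h2)).differentiableAt two_ne_zero).hasFDerivAt.comp x
      ((hu x).differentiableAt (by simp)).hasFDerivAt
    exact DFunLike.congr_fun this.fderiv v
  have hFd : ∀ x : ℂ, 0 ≤ x.re → x.re ≤ r → ∀ v, fderiv ℝ F x v =
      fderiv ℝ f (polarMap c x) (fderiv ℝ (polarMap c) x v) := fun x h1 h2 v => by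
    have := ((hf _ (hin x h1 h2)).differentiableAt one_ne_zero).hasFDerivAt.comp x
      ((hu x).differentiableAt (by simp)).hasFDerivAt
    exact DFunLike.congr_fun this.fderiv v
  have key := integral_rect_fderiv_sub (P := fun x => F x * fderiv ℝ G x 1)
    (R := fun x => F x * fderiv ℝ G x Complex.I) hab
    (fun p hp => contDiffAt_mul_fderiv (hF p hp) (hG p hp) 1)
    (fun p hp => contDiffAt_mul_fderiv (hF p hp) (hG p hp) Complex.I)
  -- the two horizontal sides cancel by periodicity in the angle
  have hper : ∀ s : ℝ, (fun x => F x * fderiv ℝ G x 1) ⟨s, b.2⟩ =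
      (fun x => F x * fderiv ℝ G x 1) ⟨s, a.2⟩ := fun s => by
    have h1 : (⟨s, b.2⟩ : ℂ) = ⟨s, a.2⟩ + (2 * Real.pi : ℝ) * Complex.I := by
      apply Complex.ext <;> simp [a, b]
      ring
    have h2 : fderiv ℝ G (⟨s, a.2⟩ + (2 * Real.pi : ℝ) * Complex.I) = fderiv ℝ G ⟨s, a.2⟩ := by
      rw [← fderiv_comp_add_right]
      simp only [G, polarMap_add_two_pi]
    simp only [h1, h2]
    simp only [F, polarMap_add_two_pi]
  -- the side of radius zero contributes nothing
  have hzero : ∀ t : ℝ, (fun x => F x * fderiv ℝ G x Complex.I) ⟨a.1, t⟩ = 0 := fun t => by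
    simp only
    rw [hGd _ le_rfl hr.le, fderiv_polarMap]
    simp [a]
  simp only [hper, hzero, sub_self, zero_add, intervalIntegral.integral_zero, sub_zero] at key
  have hcirc : ∀ t : ℝ, F ⟨b.1, t⟩ * fderiv ℝ G ⟨b.1, t⟩ Complex.I =
      f (circleMap c r t) * fderiv ℝ q (circleMap c r t) (deriv (circleMap c r) t) := fun t => by
    rw [hGd _ hr.le le_rfl, fderiv_polarMap, deriv_circleMap]
    simp only [F, polarMap, circleMap, b]
    simp [mul_assoc]
  simp only [hcirc] at key
  have hshift := Function.Periodic.intervalIntegral_add_eq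
    (f := fun t => f (circleMap c r t) * fderiv ℝ q (circleMap c r t) (deriv (circleMap c r) t))
    (T := 2 * Real.pi) (fun t => by
      simp only [deriv_circleMap, (periodic_circleMap c r) t, (periodic_circleMap 0 r) t])
    0 (-Real.pi)
  rw [zero_add, show -Real.pi + 2 * Real.pi = Real.pi by ring] at hshift
  rw [hshift]
  refine Eq.trans ?_ key
  -- the disk integral in polar coordinates
  set J : ℂ → ℂ := fun x => wedge (fderiv ℝ f x) (fderiv ℝ q x) 1 Complex.I with hJ
  have h1 : ∫ x in Metric.ball c r, J x =
      ∫ x : ℂ, (Metric.ball (0 : ℂ) r).indicator (fun x => J (c + x)) x := by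
    rw [← integral_indicator Metric.isOpen_ball.measurableSet,
      ← integral_add_left_eq_self _ c]
    congr 1
    ext x
    by_cases hx : x ∈ Metric.ball (0 : ℂ) r
    · rw [indicator_of_mem hx, indicator_of_mem (by simpa using hx)]
    · rw [indicator_of_notMem hx, indicator_of_notMem (by simpa using hx)]
  rw [h1, ← Complex.integral_comp_polarCoord_symm, polarCoord_target]
  have hpol : ∀ p : ℝ × ℝ, c + Complex.polarCoord.symm p =
      polarMap c (Complex.equivRealProdCLM.symm p) := fun p => by
    rw [Complex.polarCoord_symm_apply, polarMap, Complex.exp_mul_I]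
    simp
  have hae : Ioo 0 r ×ˢ Ioo (-Real.pi) Real.pi =ᵐ[volume] Icc a b := by
    rw [← Icc_prod_Icc]
    exact Measure.set_prod_ae_eq Ioo_ae_eq_Icc Ioo_ae_eq_Icc
  have hm : MeasurableSet (Ioo 0 r ×ˢ Ioo (-Real.pi) Real.pi) :=
    measurableSet_Ioo.prod measurableSet_Ioo
  rw [← setIntegral_congr_set hae]
  have hnorm : ∀ p : ℝ × ℝ, ‖(Complex.polarCoord.symm p : ℂ)‖ = |p.1| := fun p =>
    Complex.norm_polarCoord_symm p
  rw [setIntegral_eq_of_subset_of_forall_sdiff_eq_zero (measurableSet_Ioi.prod measurableSet_Ioo)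
    (prod_mono_left (Ioo_subset_Ioi_self : Ioo 0 r ⊆ Ioi 0))]
  · refine setIntegral_congr_fun hm fun p hp => ?_
    have hp' : p ∈ Icc a b := ⟨⟨hp.1.1.le, hp.2.1.le⟩, ⟨hp.1.2.le, hp.2.2.le⟩⟩
    rw [indicator_of_mem (by
      rw [mem_ball_zero_iff, hnorm, abs_of_pos hp.1.1]; exact hp.1.2), hpol]
    have hx1 := hp'.1.1
    have hx2 := hp'.2.1
    rw [fderiv_mul_fderiv_sub ((hF p hp').differentiableAt one_ne_zero) (hG p hp')]
    set x := Complex.equivRealProdCLM.symm p with hxdef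
    have hw := wedge_comp (fderiv ℝ f (polarMap c x)) (fderiv ℝ q (polarMap c x))
      (ContinuousLinearMap.id ℝ ℂ) (fderiv ℝ (polarMap c) x)
    simp only [ContinuousLinearMap.id_apply] at hw
    have hdet : LinearMap.det (fderiv ℝ (polarMap c) x : ℂ →ₗ[ℝ] ℂ) = p.1 := by
      rw [Complex.det_eq_re_im, fderiv_polarMap, fderiv_polarMap]
      have hxr : x.re = p.1 := rfl
      simp [Complex.exp_re, Complex.exp_im, hxr]
      nlinarith [Real.sin_sq_add_cos_sq x.im]
    rw [hdet] at hw
    rw [Complex.real_smul, hJ]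
    simp only
    rw [← hw]
    simp only [wedge]
    rw [hFd x hx1 hx2, hFd x hx1 hx2, hGd x hx1 hx2, hGd x hx1 hx2]
  · rintro p ⟨⟨hp1, hp2⟩, hp⟩
    rw [indicator_of_notMem, smul_zero]
    rw [mem_ball_zero_iff, hnorm, abs_of_pos hp1]
    exact fun h => hp ⟨⟨hp1, h⟩, hp2⟩

/-! ### Integration of `2`-forms over an oriented surface -/

theorem wedge_smul_left {E : Type*} [NormedAddCommGroup E] [NormedSpace ℝ E] (s : ℝ)
    (a b : E →L[ℝ] ℂ) (u v : E) : wedge (s • a) b u v = s * wedge a b u v := by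
  simp only [wedge, smul_apply, Complex.real_smul]
  ring

theorem wedge_sum_left {E ι : Type*} [NormedAddCommGroup E] [NormedSpace ℝ E] (s : Finset ι)
    (a : ι → E →L[ℝ] ℂ) (b : E →L[ℝ] ℂ) (u v : E) :
    wedge (∑ i ∈ s, a i) b u v = ∑ i ∈ s, wedge (a i) b u v := by
  simp only [wedge, sum_apply, Finset.sum_mul, Finset.sum_sub_distrib]

theorem wedge_zero_left {E : Type*} [NormedAddCommGroup E] [NormedSpace ℝ E]
    (b : E →L[ℝ] ℂ) (u v : E) : wedge 0 b u v = 0 := by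
  simp [wedge]

/-- A small coordinate half disk of an oriented surface inside the open set `Ω`, cut out by an
open subset `W` of the ambient space and equipped with a left inverse of the parametrization. The
points that are mapped into `W` stay away from the boundary circle of the disk, so that functions
supported in `W` have compact support in the parameter disk. -/
structure SurfacePatch (S : OrientedSurface) (Ω : Set (ℂ × ℂ)) where
  O : Set ℂ
  φ : ℂ → ℂ × ℂ
  mem_atlas : (O, φ) ∈ S.atlas
  center : ℂ
  radius : ℝ
  radius_pos : 0 < radius
  closedBall_subset : Metric.closedBall center radius ⊆ O
  map_mem : ∀ x ∈ Metric.closedBall center radius, φ x ∈ Ω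
  W : Set (ℂ × ℂ)
  isOpen_W : IsOpen W
  dist_lt : ∀ x ∈ Metric.ball center radius, φ x ∈ W → dist x center < radius / 2
  covers : ∀ z ∈ S.carrier, z ∈ W → ∃ x ∈ Metric.ball center radius, 0 ≤ x.im ∧ φ x = z
  leftInv : ℂ × ℂ → ℂ
  leftInv_apply : ∀ x ∈ Metric.ball center radius, leftInv (φ x) = x
  differentiableAt_leftInv : ∀ z ∈ W, DifferentiableAt ℝ leftInv z

namespace SurfacePatch

variable {S : OrientedSurface} {Ω : Set (ℂ × ℂ)}

theorem isLocalParam (c : SurfacePatch S Ω) : IsLocalParam S.carrier c.O c.φ :=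
  S.isLocalParam _ c.mem_atlas

/-- The parameter domain of a patch. -/
def dom (c : SurfacePatch S Ω) : Set ℂ := Metric.ball c.center c.radius ∩ upperPlane

theorem measurableSet_dom (c : SurfacePatch S Ω) : MeasurableSet c.dom :=
  Metric.isOpen_ball.measurableSet.inter isClosed_upperPlane.measurableSet

theorem ball_subset (c : SurfacePatch S Ω) : Metric.ball c.center c.radius ⊆ c.O :=
  Metric.ball_subset_closedBall.trans c.closedBall_subset

theorem dom_subset (c : SurfacePatch S Ω) : c.dom ⊆ c.O ∩ upperPlane :=
  inter_subset_inter_left _ c.ball_subset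

theorem exists_mem_W (hΩ : IsOpen Ω) (hS : S.carrier ⊆ Ω) {p : ℂ × ℂ} (hp : p ∈ S.carrier) :
    ∃ c : SurfacePatch S Ω, p ∈ c.W := by
  obtain ⟨⟨O, φ⟩, hc, x, hx, hxi, rfl⟩ := S.covers p hp
  have h := S.isLocalParam _ hc
  obtain ⟨l, hl, hl'⟩ := exists_local_leftInverse (h.contDiffAt hx) (h.immersion x hx)
  have hO : ∀ᶠ y in 𝓝 x, y ∈ O := h.isOpen.mem_nhds hx
  have hφΩ : ∀ᶠ y in 𝓝 x, φ y ∈ Ω :=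
    (h.differentiableAt hx).continuousAt.eventually (hΩ.mem_nhds (hS hp))
  obtain ⟨r, hr, hball⟩ := Metric.nhds_basis_closedBall.mem_iff.1 (hO.and (hφΩ.and hl))
  have hlc : ∀ᶠ z in 𝓝 (φ x), dist (l z) x < r / 2 := by
    have h1 : ContinuousAt l (φ x) := hl'.self_of_nhds.continuousAt
    have h2 : Tendsto l (𝓝 (φ x)) (𝓝 x) := by
      have := hl.self_of_nhds
      rw [ContinuousAt, this] at h1
      exact h1
    exact h2.eventually (Metric.ball_mem_nhds x (half_pos hr))
  have hcov := eventually_nhdsWithin_iff.1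
    (h.eventually_mem_image hx hxi (Metric.ball_mem_nhds x hr))
  obtain ⟨W, hW, hWo, hpW⟩ := mem_nhds_iff.1 (hl'.and (hlc.and hcov))
  exact ⟨{
    O := O
    φ := φ
    mem_atlas := hc
    center := x
    radius := r
    radius_pos := hr
    closedBall_subset := fun y hy => (hball hy).1
    map_mem := fun y hy => (hball hy).2.1
    W := W
    isOpen_W := hWo
    dist_lt := fun y hy hyW => by
      have := (hW hyW).2.1
      rwa [(hball (Metric.ball_subset_closedBall hy)).2.2] at this
    covers := fun z hzS hzW => by
      obtain ⟨y, hy, hyi, hyz⟩ := (hW hzW).2.2 hzS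
      exact ⟨y, hy.1, hyi, hyz⟩
    leftInv := l
    leftInv_apply := fun y hy => (hball (Metric.ball_subset_closedBall hy)).2.2
    differentiableAt_leftInv := fun z hz => (hW hz).1.differentiableAt one_ne_zero }, hpW⟩

end SurfacePatch

/-- Finitely many patches of an oriented surface together with a smooth partition of unity that
is subordinate to them and sums to `1` on a neighbourhood of the surface. -/
structure PatchSystem (S : OrientedSurface) (Ω : Set (ℂ × ℂ)) where
  ι : Type
  fintype : Fintype ι
  patch : ι → SurfacePatch S Ω
  χ : ι → ℂ × ℂ → ℝ
  contDiff : ∀ i, ContDiff ℝ ∞ (χ i)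
  tsupport_subset : ∀ i, tsupport (χ i) ⊆ (patch i).W
  sum_eq_one : ∀ p ∈ S.carrier, ∀ᶠ z in 𝓝 p, ∑ i, χ i z = 1

attribute [instance] PatchSystem.fintype

theorem PatchSystem.exists_patchSystem {S : OrientedSurface} {Ω : Set (ℂ × ℂ)} (hΩ : IsOpen Ω)
    (hS : S.carrier ⊆ Ω) : Nonempty (PatchSystem S Ω) := by
  let c' : S.carrier → SurfacePatch S Ω := fun p =>
    (SurfacePatch.exists_mem_W hΩ hS p.2).choose
  have hc' : ∀ p : S.carrier, (p : ℂ × ℂ) ∈ (c' p).W := fun p =>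
    (SurfacePatch.exists_mem_W hΩ hS p.2).choose_spec
  obtain ⟨t, ht⟩ := S.isCompact.elim_finite_subcover (fun p : S.carrier => (c' p).W)
    (fun p => (c' p).isOpen_W) (fun p hp => mem_iUnion.2 ⟨⟨p, hp⟩, hc' ⟨p, hp⟩⟩)
  let U : Fin t.card → Set (ℂ × ℂ) := fun i => (c' (t.equivFin.symm i)).W
  have hU : ∀ i, IsOpen (U i) := fun i => (c' _).isOpen_W
  have hSU : S.carrier ⊆ ⋃ i, U i := fun p hp => by
    obtain ⟨q, hq, hpq⟩ := mem_iUnion₂.1 (ht hp)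
    refine mem_iUnion.2 ⟨t.equivFin ⟨q, hq⟩, ?_⟩
    simpa [U] using hpq
  obtain ⟨K, hK, hSK, hKU⟩ := exists_compact_between S.isCompact (isOpen_iUnion hU) hSU
  obtain ⟨f, hf⟩ := SmoothPartitionOfUnity.exists_isSubordinate (modelWithCornersSelf ℝ (ℂ × ℂ))
    hK.isClosed U hU hKU
  exact ⟨{
    ι := Fin t.card
    fintype := inferInstance
    patch := fun i => c' (t.equivFin.symm i)
    χ := fun i => f i
    contDiff := fun i => (f i).contMDiff.contDiff
    tsupport_subset := hf
    sum_eq_one := fun p hp => by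
      filter_upwards [mem_interior_iff_mem_nhds.1 (hSK hp)] with z hz
      rw [← finsum_eq_sum_of_fintype]
      exact f.sum_eq_one hz }⟩

theorem IsLocalParam.integrableOn_pullWedge {S : Set (ℂ × ℂ)} {O : Set ℂ} {φ : ℂ → ℂ × ℂ}
    (h : IsLocalParam S O φ) {Ω : Set (ℂ × ℂ)} {α β : ℂ × ℂ → ℂ × ℂ →L[ℝ] ℂ}
    (hα : ∀ z ∈ Ω, ContinuousAt α z) (hβ : ∀ z ∈ Ω, ContinuousAt β z) {K E : Set ℂ}
    (hK : IsCompact K) (hKO : K ⊆ O) (hKΩ : ∀ x ∈ K, φ x ∈ Ω) (hE : E ⊆ K) :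
    IntegrableOn (pullWedge α β φ) E := by
  refine (ContinuousOn.integrableOn_compact hK fun x hx => ?_).mono_set hE
  have h1 := (h.differentiableAt (hKO hx)).continuousAt
  have ha : ContinuousAt (fun x => α (φ x)) x := (hα _ (hKΩ x hx)).comp h1
  have hb : ContinuousAt (fun x => β (φ x)) x := (hβ _ (hKΩ x hx)).comp h1
  have hd : ContinuousAt (fderiv ℝ φ) x :=
    ((h.contDiffAt (hKO hx)).fderiv_right (m := 0) (by simp)).continuousAt
  have hd' : ∀ v, ContinuousAt (fun x => fderiv ℝ φ x v) x := fun v =>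
    hd.clm_apply continuousAt_const
  exact (((ha.clm_apply (hd' _)).mul (hb.clm_apply (hd' _))).sub
    ((ha.clm_apply (hd' _)).mul (hb.clm_apply (hd' _)))).continuousWithinAt

namespace PatchSystem

variable {S : OrientedSurface} {Ω : Set (ℂ × ℂ)}

/-- The integral of the `2`-form `α ∧ β` over the oriented surface. -/
noncomputable def surfInt (Λ : PatchSystem S Ω) (α β : ℂ × ℂ → ℂ × ℂ →L[ℝ] ℂ) : ℂ :=
  ∑ i, ∫ x in (Λ.patch i).dom, pullWedge (fun z => Λ.χ i z • α z) β (Λ.patch i).φ x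

theorem χ_eq_zero (Λ : PatchSystem S Ω) {i : Λ.ι} {z : ℂ × ℂ} (hz : z ∉ (Λ.patch i).W) :
    Λ.χ i z = 0 :=
  image_eq_zero_of_notMem_tsupport fun h => hz (Λ.tsupport_subset i h)

theorem continuousAt_smul (Λ : PatchSystem S Ω) {α : ℂ × ℂ → ℂ × ℂ →L[ℝ] ℂ}
    (hα : ∀ z ∈ Ω, ContinuousAt α z) (i : Λ.ι) :
    ∀ z ∈ Ω, ContinuousAt (fun z => Λ.χ i z • α z) z := fun z hz =>
  (Λ.contDiff i).continuous.continuousAt.smul (hα z hz)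

/-- A `2`-form that is supported in the image of a single positively oriented parametrization can
be integrated in that parametrization. -/
theorem surfInt_eq_setIntegral (Λ : PatchSystem S Ω) {α β : ℂ × ℂ → ℂ × ℂ →L[ℝ] ℂ}
    (hα : ∀ z ∈ Ω, ContinuousAt α z) (hβ : ∀ z ∈ Ω, ContinuousAt β z)
    {O : Set ℂ} {φ : ℂ → ℂ × ℂ} (h : S.IsPositiveParam O φ) {K E : Set ℂ}
    (hK : IsCompact K) (hKO : K ⊆ O) (hKΩ : ∀ x ∈ K, φ x ∈ Ω) (hE : MeasurableSet E)
    (hEK : E ⊆ K) (hEi : E ⊆ upperPlane)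
    (h0 : ∀ z ∈ S.carrier, z ∉ φ '' E → ∀ u v, wedge (α z) (β z) u v = 0) :
    Λ.surfInt α β = ∫ x in E, pullWedge α β φ x := by
  have hEO : E ⊆ O ∩ upperPlane := fun x hx => ⟨hKO (hEK hx), hEi hx⟩
  have key : ∀ i, ∫ x in (Λ.patch i).dom, pullWedge (fun z => Λ.χ i z • α z) β (Λ.patch i).φ x =
      ∫ x in E, pullWedge (fun z => Λ.χ i z • α z) β φ x := fun i => by
    refine (setIntegral_pullWedge_eq h.1 (Λ.patch i).isLocalParam (h.2 _ (Λ.patch i).mem_atlas) hE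
      (Λ.patch i).measurableSet_dom hEO (Λ.patch i).dom_subset ?_ ?_).symm
    · intro x hx hxi u v
      have : φ x ∉ (Λ.patch i).W := fun hW => by
        obtain ⟨y, hy, hyi, hyx⟩ := (Λ.patch i).covers _ (h.1.mem (hEO hx).1 (hEi hx)) hW
        exact hxi ⟨y, ⟨hy, hyi⟩, hyx⟩
      rw [wedge_smul_left, Λ.χ_eq_zero this]
      simp
    · intro y hy hyE u v
      rw [wedge_smul_left, h0 _ ((Λ.patch i).isLocalParam.mem ((Λ.patch i).dom_subset hy).1 hy.2)
        hyE, mul_zero]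
  rw [surfInt, Finset.sum_congr rfl fun i _ => key i, ← integral_finsetSum]
  · refine setIntegral_congr_fun hE fun x hx => ?_
    have h1 := (Λ.sum_eq_one _ (h.1.mem (hEO hx).1 (hEi hx))).self_of_nhds
    simp only [pullWedge, wedge_smul_left]
    rw [← Finset.sum_mul, ← Complex.ofReal_sum, h1, Complex.ofReal_one, one_mul]
  · exact fun i _ => h.1.integrableOn_pullWedge (Λ.continuousAt_smul hα i) hβ hK hKO hKΩ hEK

/-- Additivity of the surface integral in the first factor. Only the restriction to the surface
of the forms matters. -/
theorem surfInt_eq_sum (Λ : PatchSystem S Ω) {κ : Type*} (s : Finset κ)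
    {α : κ → ℂ × ℂ → ℂ × ℂ →L[ℝ] ℂ} {α' β : ℂ × ℂ → ℂ × ℂ →L[ℝ] ℂ}
    (hα : ∀ k ∈ s, ∀ z ∈ Ω, ContinuousAt (α k) z) (hβ : ∀ z ∈ Ω, ContinuousAt β z)
    (h : ∀ z ∈ S.carrier, ∀ u v, wedge (α' z) (β z) u v = ∑ k ∈ s, wedge (α k z) (β z) u v) :
    Λ.surfInt α' β = ∑ k ∈ s, Λ.surfInt (α k) β := by
  simp only [surfInt]
  rw [Finset.sum_comm]
  refine Finset.sum_congr rfl fun i _ => ?_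
  rw [← integral_finsetSum]
  · refine setIntegral_congr_fun (Λ.patch i).measurableSet_dom fun x hx => ?_
    have hx' := (Λ.patch i).isLocalParam.mem ((Λ.patch i).dom_subset hx).1 hx.2
    simp only [pullWedge, wedge_smul_left]
    rw [h _ hx', Finset.mul_sum]
  · exact fun k hk => (Λ.patch i).isLocalParam.integrableOn_pullWedge
      (Λ.continuousAt_smul (hα k hk) i) hβ (isCompact_closedBall _ _) (Λ.patch i).closedBall_subset
      (Λ.patch i).map_mem (inter_subset_left.trans Metric.ball_subset_closedBall)

end PatchSystem

/-! ### Stokes' theorem on an oriented surface -/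

theorem OrientedSurface.atlas_isPositiveParam (S : OrientedSurface) {O : Set ℂ} {φ : ℂ → ℂ × ℂ}
    (h : (O, φ) ∈ S.atlas) : S.IsPositiveParam O φ :=
  ⟨S.isLocalParam _ h, fun c hc => S.sameOrientation _ h c hc⟩

/-- The pullback of `df ∧ dq` is `d(f ∘ φ) ∧ d(q ∘ φ)`. -/
theorem pullWedge_fderiv {φ : ℂ → ℂ × ℂ} {f q : ℂ × ℂ → ℂ} {x : ℂ}
    (hφ : DifferentiableAt ℝ φ x) (hf : DifferentiableAt ℝ f (φ x))
    (hq : DifferentiableAt ℝ q (φ x)) : pullWedge (fderiv ℝ f) (fderiv ℝ q) φ x =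
      wedge (fderiv ℝ (fun y => f (φ y)) x) (fderiv ℝ (fun y => q (φ y)) x) 1 Complex.I := by
  have h1 : fderiv ℝ (fun y => f (φ y)) x = (fderiv ℝ f (φ x)).comp (fderiv ℝ φ x) :=
    (hf.hasFDerivAt.comp x hφ.hasFDerivAt).fderiv
  have h2 : fderiv ℝ (fun y => q (φ y)) x = (fderiv ℝ q (φ x)).comp (fderiv ℝ φ x) :=
    (hq.hasFDerivAt.comp x hφ.hasFDerivAt).fderiv
  rw [h1, h2]
  rfl

theorem fderiv_comp_param_one {φ : ℂ → ℂ × ℂ} {q : ℂ × ℂ → ℂ} {x : ℂ}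
    (hφ : DifferentiableAt ℝ φ x) (hq : DifferentiableAt ℝ q (φ x)) (v : ℂ) :
    fderiv ℝ (fun y => q (φ y)) x v = fderiv ℝ q (φ x) (fderiv ℝ φ x v) :=
  DFunLike.congr_fun (hq.hasFDerivAt.comp x hφ.hasFDerivAt).fderiv v

namespace OrientedSurface.IsOrientedBoundary

variable {S : OrientedSurface} {γ : ℝ → ℂ × ℂ}

theorem mem_carrier (hγ : S.IsOrientedBoundary γ) (t : ℝ) : γ t ∈ S.carrier := by
  obtain ⟨c, hc, x, hx, hxi, hxt⟩ := hγ.range_eq.subset (mem_range_self t)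
  rw [← hxt]
  exact (S.isLocalParam c hc).mem hx hxi.ge

/-- In every parametrization of the atlas the boundary curve runs on the real axis. -/
theorem im_eq_zero (hγ : S.IsOrientedBoundary γ) {c : Set ℂ × (ℂ → ℂ × ℂ)} (hc : c ∈ S.atlas)
    {x : ℂ} (hx : x ∈ c.1) (hxi : 0 ≤ x.im) {t : ℝ} (hxt : c.2 x = γ t) : x.im = 0 := by
  obtain ⟨c', hc', y, hy, hyi, hyt⟩ := hγ.range_eq.subset (mem_range_self t)
  by_contra hne
  have := (S.isLocalParam c' hc').im_pos_of_im_pos (S.isLocalParam c hc)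
    (S.sameOrientation c hc c' hc') hy hx hyi.ge (lt_of_le_of_ne hxi (Ne.symm hne))
    (hyt.trans hxt.symm)
  exact this.ne' hyi

theorem injOn_Ioc (hγ : S.IsOrientedBoundary γ) : InjOn γ (Ioc 0 (2 * Real.pi)) := by
  have h0 : γ (2 * Real.pi) = γ 0 := by simpa using hγ.periodic 0
  have hpi := Real.two_pi_pos
  intro s hs t ht hst
  rcases hs.2.lt_or_eq with h1 | h1 <;> rcases ht.2.lt_or_eq with h2 | h2
  · exact hγ.injOn ⟨hs.1.le, h1⟩ ⟨ht.1.le, h2⟩ hst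
  · rw [h2, h0] at hst
    exact absurd (hγ.injOn ⟨hs.1.le, h1⟩ ⟨le_rfl, hpi⟩ hst) hs.1.ne'
  · rw [h1, h0] at hst
    exact absurd (hγ.injOn ⟨le_rfl, hpi⟩ ⟨ht.1.le, h2⟩ hst) ht.1.ne
  · rw [h1, h2]

/-- The integral along the boundary curve of a `1`-form supported in a patch equals its integral
along the real axis of the parameter plane. -/
theorem integral_eq_setIntegral (hγ : S.IsOrientedBoundary γ) {Ω : Set (ℂ × ℂ)}
    (c : SurfacePatch S Ω) {f : ℂ × ℂ → ℂ} (hf : ∀ z ∉ c.W, f z = 0)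
    (β : ℂ × ℂ → ℂ × ℂ →L[ℝ] ℂ) :
    ∫ t in (0 : ℝ)..2 * Real.pi, f (γ t) * β (γ t) (deriv γ t) =
      ∫ t in {t : ℝ | (t : ℂ) ∈ Metric.ball c.center c.radius},
        f (c.φ t) * β (c.φ t) (fderiv ℝ c.φ t 1) := by
  have hγd : ∀ t, HasDerivAt γ (deriv γ t) t := fun t =>
    (hγ.contDiff.differentiable (by simp) t).hasDerivAt
  set T : Set ℝ := Ioc 0 (2 * Real.pi) ∩ γ ⁻¹' c.W with hT
  have hTm : MeasurableSet T :=
    measurableSet_Ioc.inter (c.isOpen_W.preimage hγ.contDiff.continuous).measurableSet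
  -- `a` is the position of `γ t` on the real axis of the parameter plane
  let a : ℝ → ℝ := fun t => (c.leftInv (γ t)).re
  have ha : ∀ t, γ t ∈ c.W →
      ((a t : ℝ) : ℂ) ∈ Metric.ball c.center c.radius ∧ c.φ (a t : ℝ) = γ t := fun t ht => by
    obtain ⟨x, hx, hxi, hxt⟩ := c.covers _ (hγ.mem_carrier t) ht
    have h0 : x.im = 0 := hγ.im_eq_zero c.mem_atlas (c.ball_subset hx) hxi hxt
    have hax : ((a t : ℝ) : ℂ) = x := by
      simp only [a, ← hxt, c.leftInv_apply x hx]
      apply Complex.ext <;> simp [h0]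
    rw [hax]
    exact ⟨hx, hxt⟩
  have hex : ∀ t, γ t ∈ c.W → ∃ k : ℝ, 0 < k ∧ deriv γ t = k • fderiv ℝ c.φ (a t : ℝ) 1 :=
    fun t ht => hγ.direction t _ c.mem_atlas _ (c.ball_subset (ha t ht).1) (by simp) (ha t ht).2
  choose! k hkpos hk using hex
  have had : ∀ t ∈ T, HasDerivWithinAt a (k t) T t := fun t ht => by
    have hx := (ha t ht.2).1
    have hl := (c.differentiableAt_leftInv _ ht.2).hasFDerivAt
    have hid : fderiv ℝ c.leftInv (γ t) (fderiv ℝ c.φ (a t : ℝ) 1) = 1 := by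
      have h1 : HasFDerivAt (fun x => c.leftInv (c.φ x)) (ContinuousLinearMap.id ℝ ℂ)
          ((a t : ℝ) : ℂ) := (hasFDerivAt_id _).congr_of_eventuallyEq (by
            filter_upwards [Metric.isOpen_ball.mem_nhds hx] with y hy
            exact c.leftInv_apply y hy)
      have h2 := fderiv_comp_param_one (q := c.leftInv)
        (c.isLocalParam.differentiableAt (c.ball_subset hx))
        ((ha t ht.2).2 ▸ c.differentiableAt_leftInv _ ht.2) 1
      rw [h1.fderiv, (ha t ht.2).2] at h2
      exact h2.symm
    have h3 := hl.comp_hasDerivAt t (hγd t)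
    rw [hk t ht.2, map_smul, hid] at h3
    have h4 := (Complex.reCLM.hasFDerivAt).comp_hasDerivAt t h3
    simp only [Complex.reCLM_apply, Complex.real_smul, mul_one, Complex.ofReal_re] at h4
    exact h4.hasDerivWithinAt
  have hainj : InjOn a T := fun s hs t ht hst => by
    apply hγ.injOn_Ioc hs.1 ht.1
    rw [← (ha s hs.2).2, ← (ha t ht.2).2, hst]
  have himg : a '' T = {t : ℝ | (t : ℂ) ∈ Metric.ball c.center c.radius ∧ c.φ t ∈ c.W} := by
    ext s
    constructor
    · rintro ⟨t, ht, rfl⟩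
      exact ⟨(ha t ht.2).1, by rw [(ha t ht.2).2]; exact ht.2⟩
    · rintro ⟨hs, hsW⟩
      obtain ⟨t', ht'⟩ := hγ.range_eq.superset
        ⟨_, c.mem_atlas, (s : ℂ), c.ball_subset hs, by simp, rfl⟩
      obtain ⟨t, ht, htt'⟩ := hγ.periodic.exists_mem_Ioc Real.two_pi_pos t' 0
      rw [zero_add] at ht
      have hts : γ t = c.φ s := htt'.symm.trans ht'
      refine ⟨t, ⟨ht, by rw [mem_preimage, hts]; exact hsW⟩, ?_⟩
      simp only [a, hts, c.leftInv_apply _ hs, Complex.ofReal_re]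
  have hm : MeasurableSet {t : ℝ | (t : ℂ) ∈ Metric.ball c.center c.radius} :=
    (Metric.isOpen_ball.preimage Complex.continuous_ofReal).measurableSet
  rw [setIntegral_eq_of_subset_of_forall_sdiff_eq_zero (s := a '' T) hm
      (by rw [himg]; exact fun t ht => ht.1)
      (fun t ht => by
        rw [hf, zero_mul]
        exact fun h => ht.2 (by rw [himg]; exact ⟨ht.1, h⟩)),
    integral_image_eq_integral_abs_deriv_smul hTm had hainj,
    intervalIntegral.integral_of_le Real.two_pi_pos.le,
    setIntegral_eq_of_subset_of_forall_sdiff_eq_zero (s := T) measurableSet_Ioc inter_subset_left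
      (fun t ht => by
        rw [hf, zero_mul]
        exact fun h => ht.2 ⟨ht.1, h⟩)]
  refine setIntegral_congr_fun hTm fun t ht => ?_
  rw [(ha t ht.2).2, abs_of_pos (hkpos t ht.2), hk t ht.2, map_smul]
  simp only [Complex.real_smul]
  ring

/-- Stokes' theorem for the form `g dq` on an oriented surface. -/
theorem integral_mul_fderiv_eq_surfInt (hγ : S.IsOrientedBoundary γ) {Ω : Set (ℂ × ℂ)}
    (hΩ : IsOpen Ω) (hS : S.carrier ⊆ Ω) (Λ : PatchSystem S Ω) {g q : ℂ × ℂ → ℂ}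
    (hg : ContDiffOn ℝ 1 g Ω) (hq : ContDiffOn ℝ 2 q Ω) :
    ∫ t in (0 : ℝ)..2 * Real.pi, g (γ t) * fderiv ℝ q (γ t) (deriv γ t) =
      Λ.surfInt (fderiv ℝ g) (fderiv ℝ q) := by
  have hg' : ∀ z ∈ Ω, ContDiffAt ℝ 1 g z := fun z hz => hg.contDiffAt (hΩ.mem_nhds hz)
  have hq' : ∀ z ∈ Ω, ContDiffAt ℝ 2 q z := fun z hz => hq.contDiffAt (hΩ.mem_nhds hz)
  have hqd : ∀ z ∈ Ω, DifferentiableAt ℝ q z := fun z hz => (hq' z hz).differentiableAt two_ne_zero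
  have hqc : ∀ z ∈ Ω, ContinuousAt (fderiv ℝ q) z := fun z hz =>
    ((hq' z hz).fderiv_right (m := 0) (by norm_num)).continuousAt
  let f : Λ.ι → ℂ × ℂ → ℂ := fun k z => (Λ.χ k z : ℂ) * g z
  have hf : ∀ k, ∀ z ∈ Ω, ContDiffAt ℝ 1 (f k) z := fun k z hz =>
    (Complex.ofRealCLM.contDiff.comp ((Λ.contDiff k).of_le (by norm_cast))).contDiffAt.mul
      (hg' z hz)
  have hfc : ∀ k, ∀ z ∈ Ω, ContinuousAt (fderiv ℝ (f k)) z := fun k z hz =>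
    ((hf k z hz).fderiv_right (m := 0) (by norm_num)).continuousAt
  have hf0 : ∀ k, ∀ z ∉ (Λ.patch k).W, f k z = 0 := fun k z hz => by
    simp [f, Λ.χ_eq_zero hz]
  have hfd0 : ∀ k, ∀ z ∉ (Λ.patch k).W, fderiv ℝ (f k) z = 0 := fun k z hz => by
    have : f k =ᶠ[𝓝 z] fun _ => 0 := by
      filter_upwards [notMem_tsupport_iff_eventuallyEq.1
        fun h => hz (Λ.tsupport_subset k h)] with y hy
      simp [f, hy]
    rw [this.fderiv_eq]
    simp
  have hγS := hγ.mem_carrier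
  have hγΩ : ∀ t, γ t ∈ Ω := fun t => hS (hγS t)
  -- each summand lives in one patch, where it is Stokes' theorem on a half disk
  have hsum : ∀ k, ∫ t in (0 : ℝ)..2 * Real.pi, f k (γ t) * fderiv ℝ q (γ t) (deriv γ t) =
      Λ.surfInt (fderiv ℝ (f k)) (fderiv ℝ q) := fun k => by
    set c := Λ.patch k with hc
    have hd : ∀ x ∈ Metric.ball c.center c.radius, DifferentiableAt ℝ c.φ x := fun x hx =>
      c.isLocalParam.differentiableAt (c.ball_subset hx)
    have hcd : ∀ x ∈ Metric.ball c.center c.radius, ContDiffAt ℝ ∞ c.φ x := fun x hx =>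
      c.isLocalParam.contDiffAt (c.ball_subset hx)
    have hm : ∀ x ∈ Metric.ball c.center c.radius, c.φ x ∈ Ω := fun x hx =>
      c.map_mem x (Metric.ball_subset_closedBall hx)
    rw [hγ.integral_eq_setIntegral c (hf0 k) (fderiv ℝ q),
      Λ.surfInt_eq_setIntegral (hfc k) hqc (S.atlas_isPositiveParam c.mem_atlas)
        (isCompact_closedBall c.center c.radius) c.closedBall_subset c.map_mem c.measurableSet_dom
        (inter_subset_left.trans Metric.ball_subset_closedBall) inter_subset_right]
    · have hst := integral_halfBall_wedge (f := fun x => f k (c.φ x)) (q := fun x => q (c.φ x))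
        (x₀ := c.center) (r := c.radius)
        (fun x hx => (hf k _ (hm x hx)).comp x ((hcd x hx).of_le (by norm_cast)))
        (fun x hx => (hq' _ (hm x hx)).comp x ((hcd x hx).of_le (by norm_cast)))
        (fun x hx hxr => hf0 k _ fun hW => (c.dist_lt x hx hW).not_ge hxr) c.radius_pos
      refine Eq.trans (setIntegral_congr_fun
        (Metric.isOpen_ball.preimage Complex.continuous_ofReal).measurableSet fun t ht => ?_)
        (hst.symm.trans (setIntegral_congr_fun c.measurableSet_dom fun x hx => ?_))
      · rw [fderiv_comp_param_one (hd _ ht) (hqd _ (hm _ ht))]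
      · exact (pullWedge_fderiv (hd x hx.1)
          ((hf k _ (hm x hx.1)).differentiableAt one_ne_zero) (hqd _ (hm x hx.1))).symm
    · intro z hz hzE u v
      have : z ∉ c.W := fun hW => by
        obtain ⟨y, hy, hyi, hyz⟩ := c.covers z hz hW
        exact hzE ⟨y, ⟨hy, hyi⟩, hyz⟩
      rw [hfd0 k z this, wedge_zero_left]
  have hpart : ∀ z ∈ S.carrier, g =ᶠ[𝓝 z] fun y => ∑ k, f k y := fun z hz => by
    filter_upwards [Λ.sum_eq_one z hz] with y hy
    simp only [f]
    rw [← Finset.sum_mul, ← Complex.ofReal_sum, hy, Complex.ofReal_one, one_mul]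
  rw [Λ.surfInt_eq_sum Finset.univ (α := fun k => fderiv ℝ (f k)) (fun k _ => hfc k) hqc
    (fun z hz u v => by
      rw [(hpart z hz).fderiv_eq, fderiv_fun_sum fun k _ =>
        (hf k z (hS hz)).differentiableAt one_ne_zero, wedge_sum_left]),
    ← Finset.sum_congr rfl fun k _ => hsum k, ← intervalIntegral.integral_finsetSum]
  · refine intervalIntegral.integral_congr fun t _ => ?_
    rw [← Finset.sum_mul, ← (hpart _ (hγS t)).eq_of_nhds]
  · intro k _
    refine Continuous.intervalIntegrable (continuous_iff_continuousAt.2 fun t => ?_) _ _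
    have h1 := hγ.contDiff.continuous.continuousAt (x := t)
    exact ((hf k _ (hγΩ t)).continuousAt.comp h1).mul
      (((hqc _ (hγΩ t)).comp h1).clm_apply
        (hγ.contDiff.continuous_deriv (by simp)).continuousAt)

end OrientedSurface.IsOrientedBoundary

/-! ### The winding number as an integral of a `2`-form -/

/-- A smooth function on `ℂ` that agrees with `u ↦ u⁻¹` for `ε ≤ ‖u‖`. -/
noncomputable def cutoffInv (ε : ℝ) (u : ℂ) : ℂ :=
  ((Real.smoothTransition (2 * ‖u‖ ^ 2 / ε ^ 2 - 1) : ℝ) : ℂ) * u⁻¹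

theorem cutoffInv_eq {ε : ℝ} (hε : 0 < ε) {u : ℂ} (hu : ε ≤ ‖u‖) : cutoffInv ε u = u⁻¹ := by
  have h : 1 ≤ 2 * ‖u‖ ^ 2 / ε ^ 2 - 1 := by
    rw [le_sub_iff_add_le, le_div_iff₀ (by positivity)]
    nlinarith
  rw [cutoffInv, Real.smoothTransition.one_of_one_le h]
  simp

theorem contDiff_cutoffInv {ε : ℝ} (hε : 0 < ε) : ContDiff ℝ ∞ (cutoffInv ε) := by
  rw [contDiff_iff_contDiffAt]
  intro u
  by_cases hu : u = 0
  · subst hu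
    refine contDiffAt_const (c := (0 : ℂ)) |>.congr_of_eventuallyEq ?_
    have : ∀ᶠ u : ℂ in 𝓝 0, ‖u‖ < ε / 2 := by
      have := Metric.ball_mem_nhds (0 : ℂ) (half_pos hε)
      filter_upwards [this] with u hu
      simpa using hu
    filter_upwards [this] with u hu
    have h : 2 * ‖u‖ ^ 2 / ε ^ 2 - 1 ≤ 0 := by
      rw [sub_nonpos, div_le_one (by positivity)]
      nlinarith [norm_nonneg u]
    rw [cutoffInv, Real.smoothTransition.zero_of_nonpos h]
    simp
  · have h1 : ContDiff ℝ ∞ fun u : ℂ => 2 * ‖u‖ ^ 2 / ε ^ 2 - 1 :=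
      ((contDiff_const.mul (contDiff_norm_sq ℝ)).div_const _).sub contDiff_const
    exact (Complex.ofRealCLM.contDiff.comp
      (Real.smoothTransition.contDiff.comp h1)).contDiffAt.mul (contDiffAt_inv ℝ hu)

/-- The form `d(cutoffInv ∘ q) ∧ dq` vanishes where `q` is not small, since `dq / q` is closed. -/
theorem wedge_fderiv_cutoffInv_eq_zero {ε : ℝ} (hε : 0 < ε) {q : ℂ × ℂ → ℂ} {z : ℂ × ℂ}
    (hq : DifferentiableAt ℝ q z) (hz : ε < ‖q z‖) (u v : ℂ × ℂ) :
    wedge (fderiv ℝ (fun y => cutoffInv ε (q y)) z) (fderiv ℝ q z) u v = 0 := by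
  have h0 : q z ≠ 0 := norm_pos_iff.1 (hε.trans hz)
  have he : (fun y => cutoffInv ε (q y)) =ᶠ[𝓝 z] fun y => (q y)⁻¹ := by
    filter_upwards [hq.continuousAt.norm.eventually (lt_mem_nhds hz)] with y hy
    exact cutoffInv_eq hε hy.le
  have hd := ((hasDerivAt_inv h0).hasFDerivAt.restrictScalars ℝ).comp z hq.hasFDerivAt
  have hf : ∀ w, fderiv ℝ (fun y => cutoffInv ε (q y)) z w =
      fderiv ℝ q z w * (-(q z ^ 2)⁻¹) := fun w => by
    rw [he.fderiv_eq]
    refine (DFunLike.congr_fun hd.fderiv w).trans ?_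
    simp
  rw [wedge, hf, hf]
  ring

theorem contDiffOn_cutoffInv_comp {ε : ℝ} (hε : 0 < ε) {Ω : Set (ℂ × ℂ)} {q : ℂ × ℂ → ℂ}
    (hq : ContDiffOn ℝ ∞ q Ω) : ContDiffOn ℝ ∞ (fun y => cutoffInv ε (q y)) Ω :=
  (contDiff_cutoffInv hε).comp_contDiffOn hq

theorem two_pi_I_mul_windingNumber (q : ℂ × ℂ → ℂ) (γ : ℝ → ℂ × ℂ) :
    2 * Real.pi * Complex.I * windingNumber q γ =
      ∫ t in (0 : ℝ)..2 * Real.pi, deriv (fun s => q (γ s)) t / q (γ t) := by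
  rw [windingNumber, mul_inv_cancel_left₀ Complex.two_pi_I_ne_zero]

/-- The winding number along the boundary circle of a parameter disk, as an integral over the
disk. -/
theorem windingNumber_circleMap {S : Set (ℂ × ℂ)} {O : Set ℂ} {φ : ℂ → ℂ × ℂ}
    (h : IsLocalParam S O φ) {Ω : Set (ℂ × ℂ)} (hΩ : IsOpen Ω) {q : ℂ × ℂ → ℂ}
    (hq : ContDiffOn ℝ ∞ q Ω) {ε : ℝ} (hε : 0 < ε) {c : ℂ} {r : ℝ} (hr : 0 < r)
    (hO : Metric.closedBall c r ⊆ O) (hm : ∀ x ∈ Metric.closedBall c r, φ x ∈ Ω)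
    (hs : ∀ x ∈ Metric.sphere c r, ε ≤ ‖q (φ x)‖) :
    2 * Real.pi * Complex.I * windingNumber q (fun t => φ (circleMap c r t)) =
      ∫ x in Metric.ball c r,
        pullWedge (fderiv ℝ fun y => cutoffInv ε (q y)) (fderiv ℝ q) φ x := by
  have hqa : ∀ x ∈ Metric.closedBall c r, ContDiffAt ℝ ∞ q (φ x) := fun x hx =>
    hq.contDiffAt (hΩ.mem_nhds (hm x hx))
  have hφa : ∀ x ∈ Metric.closedBall c r, ContDiffAt ℝ ∞ φ x := fun x hx =>
    h.contDiffAt (hO hx)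
  have hqφ : ∀ x ∈ Metric.closedBall c r, ContDiffAt ℝ ∞ (fun y => q (φ y)) x := fun x hx =>
    (hqa x hx).comp x (hφa x hx)
  have hst := integral_ball_wedge (f := fun x => cutoffInv ε (q (φ x))) (q := fun x => q (φ x)) hr
    (fun x hx => ((contDiff_cutoffInv hε).contDiffAt.comp x (hqφ x hx)).of_le (by norm_cast))
    (fun x hx => (hqφ x hx).of_le (by norm_cast))
  rw [two_pi_I_mul_windingNumber]
  refine Eq.trans (intervalIntegral.integral_congr fun t _ => ?_)
    (hst.symm.trans (setIntegral_congr_fun Metric.isOpen_ball.measurableSet fun x hx => ?_))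
  · have hx := Metric.sphere_subset_closedBall (circleMap_mem_sphere c hr.le t)
    have hd := ((hqφ _ hx).differentiableAt (by simp)).hasFDerivAt.comp_hasDerivAt t
      (differentiable_circleMap c r t).hasDerivAt
    have hd' := hd.deriv
    simp only [Function.comp_def] at hd'
    rw [hd', cutoffInv_eq hε (hs _ (circleMap_mem_sphere c hr.le t)), div_eq_mul_inv, mul_comm]
  · have hx' := Metric.ball_subset_closedBall hx
    exact (pullWedge_fderiv (f := fun y => cutoffInv ε (q y))
      ((hφa x hx').differentiableAt (by simp))
      (((contDiff_cutoffInv hε).contDiffAt.comp _ (hqa x hx')).differentiableAt (by simp))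
      ((hqa x hx').differentiableAt (by simp))).symm

theorem OrientedSurface.IsOrientedBoundary.windingNumber_eq_surfInt {S : OrientedSurface}
    {γ : ℝ → ℂ × ℂ} (hγ : S.IsOrientedBoundary γ) {Ω : Set (ℂ × ℂ)} (hΩ : IsOpen Ω)
    (hS : S.carrier ⊆ Ω) (Λ : PatchSystem S Ω) {q : ℂ × ℂ → ℂ} (hq : ContDiffOn ℝ ∞ q Ω)
    {ε : ℝ} (hε : 0 < ε) (hs : ∀ t, ε ≤ ‖q (γ t)‖) :
    2 * Real.pi * Complex.I * windingNumber q γ =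
      Λ.surfInt (fderiv ℝ fun y => cutoffInv ε (q y)) (fderiv ℝ q) := by
  rw [two_pi_I_mul_windingNumber, ← hγ.integral_mul_fderiv_eq_surfInt hΩ hS Λ
    ((contDiffOn_cutoffInv_comp hε hq).of_le (by norm_cast)) (hq.of_le (by norm_cast))]
  refine intervalIntegral.integral_congr fun t _ => ?_
  have hqd : DifferentiableAt ℝ q (γ t) :=
    (hq.contDiffAt (hΩ.mem_nhds (hS (hγ.mem_carrier t)))).differentiableAt (by simp)
  have hd := hqd.hasFDerivAt.comp_hasDerivAt t
    (hγ.contDiff.differentiable (by simp) t).hasDerivAt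
  have hd' := hd.deriv
  simp only [Function.comp_def] at hd'
  rw [hd', cutoffInv_eq hε (hs t), div_eq_mul_inv, mul_comm]

/-! ### Local indices -/

theorem IsCompact.exists_pos_lt_norm {K : Set (ℂ × ℂ)} (hK : IsCompact K) {q : ℂ × ℂ → ℂ}
    (hq : ContinuousOn q K) (h0 : ∀ z ∈ K, q z ≠ 0) : ∃ ε > 0, ∀ z ∈ K, ε < ‖q z‖ := by
  obtain ⟨a, ha, h⟩ := hK.exists_forall_le' hq.norm (a := 0) fun z hz => norm_pos_iff.2 (h0 z hz)
  exact ⟨a / 2, half_pos ha, fun z hz => (half_lt_self ha).trans_le (h z hz)⟩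

theorem im_nonneg {x : ℂ} (hx : x ∈ {x : ℂ | 0 < x.im}) : 0 ≤ x.im := le_of_lt hx

/-- The image of an open parameter disk is relatively open in the surface. -/
theorem IsLocalParam.exists_isOpen_image_ball {S : Set (ℂ × ℂ)} {O : Set ℂ} {φ : ℂ → ℂ × ℂ}
    (h : IsLocalParam S O φ) {c : ℂ} {r : ℝ}
    (hO : Metric.closedBall c r ⊆ O ∩ {x | 0 < x.im}) :
    ∃ V : Set (ℂ × ℂ), IsOpen V ∧ φ '' Metric.ball c r = S ∩ V := by
  have hb := Metric.ball_subset_closedBall.trans hO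
  obtain ⟨V, hV, hVe⟩ := h.image_open (Metric.ball c r) Metric.isOpen_ball fun x hx => (hb hx).1
  refine ⟨V, hV, hVe ▸ ?_⟩
  rw [inter_eq_self_of_subset_left]
  exact fun x hx => im_nonneg (hb hx).2

theorem IsLocalParam.isCompact_image_closedBall {S : Set (ℂ × ℂ)} {O : Set ℂ} {φ : ℂ → ℂ × ℂ}
    (h : IsLocalParam S O φ) {c : ℂ} {r : ℝ}
    (hO : Metric.closedBall c r ⊆ O ∩ {x | 0 < x.im}) :
    IsCompact (φ '' Metric.closedBall c r) :=
  (isCompact_closedBall c r).image_of_continuousOn fun _ hx =>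
    (h.differentiableAt (hO hx).1).continuousAt.continuousWithinAt

/-- Two disks in the surface around the only zero of `q` in a region have the same winding
number: both winding numbers are integrals of `d(cutoffInv ∘ q) ∧ dq`, and the cutoff can be
chosen so that this form is supported in the intersection of the disks. -/
theorem windingNumber_disk_eq {S : Set (ℂ × ℂ)} {O O' : Set ℂ} {φ ψ : ℂ → ℂ × ℂ}
    (h : IsLocalParam S O φ) (h' : IsLocalParam S O' ψ) (hor : SameOrientation O φ O' ψ)
    {Ω W : Set (ℂ × ℂ)} (hΩ : IsOpen Ω) {q : ℂ × ℂ → ℂ} (hq : ContDiffOn ℝ ∞ q Ω) (hW : W ⊆ Ω)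
    {p : ℂ × ℂ} (h0 : ∀ z ∈ S ∩ W, q z = 0 → z = p) {c c' : ℂ} {r r' : ℝ} (hr : 0 < r)
    (hr' : 0 < r') (hO : Metric.closedBall c r ⊆ O ∩ {x | 0 < x.im})
    (hO' : Metric.closedBall c' r' ⊆ O' ∩ {x | 0 < x.im}) (hp : p ∈ φ '' Metric.ball c r)
    (hp' : p ∈ ψ '' Metric.ball c' r') (hWφ : φ '' Metric.closedBall c r ⊆ W)
    (hWψ : ψ '' Metric.closedBall c' r' ⊆ W) :
    windingNumber q (fun t => φ (circleMap c r t)) =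
      windingNumber q (fun t => ψ (circleMap c' r' t)) := by
  obtain ⟨V, hV, hVe⟩ := h.exists_isOpen_image_ball hO
  obtain ⟨V', hV', hVe'⟩ := h'.exists_isOpen_image_ball hO'
  have hSφ : φ '' Metric.closedBall c r ⊆ S := by
    rintro _ ⟨x, hx, rfl⟩
    exact h.mem (hO hx).1 (im_nonneg (hO hx).2)
  have hSψ : ψ '' Metric.closedBall c' r' ⊆ S := by
    rintro _ ⟨x, hx, rfl⟩
    exact h'.mem (hO' hx).1 (im_nonneg (hO' hx).2)
  set K := (φ '' Metric.closedBall c r ∪ ψ '' Metric.closedBall c' r') \ (V ∩ V') with hKdef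
  have hKc : IsCompact K :=
    ((h.isCompact_image_closedBall hO).union (h'.isCompact_image_closedBall hO')).diff
      (hV.inter hV')
  have hKS : K ⊆ S ∩ W := fun z hz =>
    ⟨union_subset hSφ hSψ hz.1, union_subset hWφ hWψ hz.1⟩
  obtain ⟨ε, hε, hK⟩ := hKc.exists_pos_lt_norm
    (hq.continuousOn.mono fun z hz => hW (hKS hz).2) (fun z hz hz0 => by
      have := h0 z (hKS hz) hz0
      subst this
      exact hz.2 ⟨(hVe.subset hp).2, (hVe'.subset hp').2⟩)
  have hqd : ∀ z ∈ K, DifferentiableAt ℝ q z := fun z hz =>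
    (hq.contDiffAt (hΩ.mem_nhds (hW (hKS hz).2))).differentiableAt (by simp)
  have hs : ∀ x ∈ Metric.sphere c r, ε ≤ ‖q (φ x)‖ := fun x hx => by
    have hxb := Metric.sphere_subset_closedBall hx
    refine (hK _ ⟨Or.inl (mem_image_of_mem _ hxb), fun hx' => ?_⟩).le
    obtain ⟨y, hy, hyx⟩ := hVe.superset ⟨hSφ (mem_image_of_mem _ hxb), hx'.1⟩
    have hyb := Metric.ball_subset_closedBall hy
    have := h.injOn ⟨(hO hyb).1, (im_nonneg (hO hyb).2)⟩ ⟨(hO hxb).1, (im_nonneg (hO hxb).2)⟩ hyx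
    subst this
    exact (Metric.mem_ball.1 hy).ne (Metric.mem_sphere.1 hx)
  have hs' : ∀ x ∈ Metric.sphere c' r', ε ≤ ‖q (ψ x)‖ := fun x hx => by
    have hxb := Metric.sphere_subset_closedBall hx
    refine (hK _ ⟨Or.inr (mem_image_of_mem _ hxb), fun hx' => ?_⟩).le
    obtain ⟨y, hy, hyx⟩ := hVe'.superset ⟨hSψ (mem_image_of_mem _ hxb), hx'.2⟩
    have hyb := Metric.ball_subset_closedBall hy
    have := h'.injOn ⟨(hO' hyb).1, im_nonneg (hO' hyb).2⟩ ⟨(hO' hxb).1, im_nonneg (hO' hxb).2⟩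
      hyx
    subst this
    exact (Metric.mem_ball.1 hy).ne (Metric.mem_sphere.1 hx)
  have e1 := windingNumber_circleMap h hΩ hq hε hr (fun x hx => (hO hx).1)
    (fun x hx => hW (hWφ (mem_image_of_mem _ hx))) hs
  have e2 := windingNumber_circleMap h' hΩ hq hε hr' (fun x hx => (hO' hx).1)
    (fun x hx => hW (hWψ (mem_image_of_mem _ hx))) hs'
  have hb : Metric.ball c r ⊆ O ∩ upperPlane := fun x hx =>
    ⟨(hO (Metric.ball_subset_closedBall hx)).1,
      im_nonneg (hO (Metric.ball_subset_closedBall hx)).2⟩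
  have hb' : Metric.ball c' r' ⊆ O' ∩ upperPlane := fun x hx =>
    ⟨(hO' (Metric.ball_subset_closedBall hx)).1,
      im_nonneg (hO' (Metric.ball_subset_closedBall hx)).2⟩
  have e3 := setIntegral_pullWedge_eq h h' hor (α := fderiv ℝ fun y => cutoffInv ε (q y))
    (β := fderiv ℝ q) Metric.isOpen_ball.measurableSet Metric.isOpen_ball.measurableSet hb hb'
    (fun x hx hx' u v => by
      have hxK : φ x ∈ K := ⟨Or.inl (mem_image_of_mem _ (Metric.ball_subset_closedBall hx)),
        fun hV'' => hx' (hVe'.superset ⟨h.mem (hb hx).1 (hb hx).2, hV''.2⟩)⟩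
      exact wedge_fderiv_cutoffInv_eq_zero hε (hqd _ hxK) (hK _ hxK) u v)
    (fun x hx hx' u v => by
      have hxK : ψ x ∈ K := ⟨Or.inr (mem_image_of_mem _ (Metric.ball_subset_closedBall hx)),
        fun hV'' => hx' (hVe.superset ⟨h'.mem (hb' hx).1 (hb' hx).2, hV''.1⟩)⟩
      exact wedge_fderiv_cutoffInv_eq_zero hε (hqd _ hxK) (hK _ hxK) u v)
  exact mul_left_cancel₀ Complex.two_pi_I_ne_zero (e1.trans (e3.trans e2.symm))

namespace OrientedSurface

variable {S : OrientedSurface}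

/-- A point of the surface off its boundary lies in arbitrarily small coordinate disks. -/
theorem exists_disk_of_notMem_boundary {p : ℂ × ℂ} (hp : p ∈ S.carrier) (hb : p ∉ S.boundary)
    {V : Set (ℂ × ℂ)} (hV : V ∈ 𝓝 p) :
    ∃ (O : Set ℂ) (φ : ℂ → ℂ × ℂ) (c : ℂ) (r : ℝ), (O, φ) ∈ S.atlas ∧ 0 < r ∧
      Metric.closedBall c r ⊆ O ∩ {x | 0 < x.im} ∧ p ∈ φ '' Metric.ball c r ∧
      φ '' Metric.closedBall c r ⊆ V := by
  obtain ⟨⟨O, φ⟩, hc, x, hx, hxi, rfl⟩ := S.covers p hp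
  have hxi' : 0 < x.im := lt_of_le_of_ne hxi fun h0 => hb ⟨_, hc, x, hx, h0.symm, rfl⟩
  have h := S.isLocalParam _ hc
  have h1 : ∀ᶠ y in 𝓝 x, y ∈ O := h.isOpen.mem_nhds hx
  have h2 : ∀ᶠ y in 𝓝 x, 0 < y.im :=
    Complex.continuous_im.continuousAt.eventually (lt_mem_nhds hxi')
  have h3 : ∀ᶠ y in 𝓝 x, φ y ∈ V := (h.differentiableAt hx).continuousAt.eventually hV
  obtain ⟨r, hr, hball⟩ := Metric.nhds_basis_closedBall.mem_iff.1 (h1.and (h2.and h3))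
  refine ⟨O, φ, x, r, hc, hr, fun y hy => ⟨(hball hy).1, (hball hy).2.1⟩,
    mem_image_of_mem _ (Metric.mem_ball_self hr), ?_⟩
  rintro _ ⟨y, hy, rfl⟩
  exact (hball hy).2.2

/-- The local index exists at every isolated zero off the boundary. -/
theorem exists_isLocalIndex {Ω : Set (ℂ × ℂ)} (hΩ : IsOpen Ω) (hS : S.carrier ⊆ Ω)
    {q : ℂ × ℂ → ℂ} (hq : ContDiffOn ℝ ∞ q Ω) {p : ℂ × ℂ} (hp : p ∈ S.carrier)
    (hb : p ∉ S.boundary) (hiso : ∀ᶠ z in 𝓝[S.carrier] p, q z = 0 → z = p) :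
    ∃ ι, IsLocalIndex q S p ι := by
  obtain ⟨W, hW, hWo, hpW⟩ := mem_nhds_iff.1
    ((eventually_nhdsWithin_iff.1 hiso).and (hΩ.mem_nhds (hS hp)))
  obtain ⟨O, φ, c, r, hc, hr, hO, hpφ, hφW⟩ :=
    S.exists_disk_of_notMem_boundary hp hb (hWo.mem_nhds hpW)
  refine ⟨-(1 / 2) * windingNumber q (fun t => φ (circleMap c r t)), W, hWo, hpW, ?_⟩
  intro O' ψ c' r' hψ hr' hO' hpψ hψW
  rw [windingNumber_disk_eq hψ.1 (S.isLocalParam _ hc) (hψ.2 _ hc) hΩ hq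
    (fun z hz => (hW hz).2) (fun z hz => (hW hz.2).1 hz.1) hr' hr hO' hO hpψ hpφ hψW hφW]

theorem isLocalIndex_localIndex {q : ℂ × ℂ → ℂ} {p : ℂ × ℂ} (h : ∃ ι, IsLocalIndex q S p ι) :
    IsLocalIndex q S p (localIndex q S p) := by
  rw [localIndex, dif_pos h]
  exact h.choose_spec

/-- A continuous cutoff around `p`, equal to `1` within distance `δ` and to `0` from distance
`2 * δ` on. -/
noncomputable def cutoffAt (p : ℂ × ℂ) (δ : ℝ) (z : ℂ × ℂ) : ℝ := max 0 (min 1 (2 - dist z p / δ))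

theorem continuous_cutoffAt (p : ℂ × ℂ) (δ : ℝ) : Continuous (cutoffAt p δ) := by
  unfold cutoffAt
  fun_prop

theorem cutoffAt_eq_one {p z : ℂ × ℂ} {δ : ℝ} (hδ : 0 < δ) (h : dist z p < δ) :
    cutoffAt p δ z = 1 := by
  have : dist z p / δ ≤ 1 := (div_le_one hδ).2 h.le
  rw [cutoffAt, min_eq_left (by linarith), max_eq_right zero_le_one]

theorem cutoffAt_eq_zero {p z : ℂ × ℂ} {δ : ℝ} (hδ : 0 < δ) (h : 2 * δ ≤ dist z p) :
    cutoffAt p δ z = 0 := by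
  have : 2 ≤ dist z p / δ := (le_div_iff₀ hδ).2 h
  rw [cutoffAt, max_eq_left]
  exact (min_le_right _ _).trans (by linarith)

/-- The argument principle on an oriented surface: if `q` does not vanish on the boundary and has
finitely many zeros, its winding number along the boundary is the sum of the local ones. -/
theorem IsOrientedBoundary.windingNumber_eq_sum_localIndex {γ : ℝ → ℂ × ℂ}
    (hγ : S.IsOrientedBoundary γ) {Ω : Set (ℂ × ℂ)} (hΩ : IsOpen Ω) (hS : S.carrier ⊆ Ω)
    {q : ℂ × ℂ → ℂ} (hq : ContDiffOn ℝ ∞ q Ω) (hγ0 : ∀ t, q (γ t) ≠ 0)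
    (Z : Finset (ℂ × ℂ)) (hZ : ∀ z, z ∈ Z ↔ z ∈ S.carrier ∧ q z = 0)
    (hι : ∀ p ∈ Z, IsLocalIndex q S p (localIndex q S p)) :
    windingNumber q γ = -2 * ∑ p ∈ Z, localIndex q S p := by
  obtain ⟨Λ⟩ := PatchSystem.exists_patchSystem hΩ hS
  obtain ⟨U, hU, hUd⟩ := Z.finite_toSet.t2_separation
  have hb : ∀ p ∈ Z, p ∉ S.boundary := fun p hp hpb => by
    rw [← hγ.range_eq] at hpb
    obtain ⟨t, rfl⟩ := hpb
    exact hγ0 t ((hZ _).1 hp).2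
  choose! W hWo hpW hW using hι
  have hδ : ∀ p ∈ Z, ∃ δ > 0, Metric.ball p (2 * δ) ⊆ U p := fun p _ => by
    obtain ⟨δ, hδ, h⟩ := Metric.isOpen_iff.1 (hU p).2 p (hU p).1
    exact ⟨δ / 2, half_pos hδ, by rwa [mul_div_cancel₀ _ two_ne_zero]⟩
  choose! δ hδ hδU using hδ
  have hdisk : ∀ p ∈ Z, _ := fun p hp =>
    S.exists_disk_of_notMem_boundary ((hZ p).1 hp).1 (hb p hp)
      (inter_mem ((hWo p hp).mem_nhds (hpW p hp)) (Metric.ball_mem_nhds p (hδ p hp)))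
  choose! O φ c r hc hr hO hpφ hφ using hdisk
  have hpar : ∀ p ∈ Z, IsLocalParam S.carrier (O p) (φ p) := fun p hp => S.isLocalParam _ (hc p hp)
  choose! V hV hVe using fun p hp => (hpar p hp).exists_isOpen_image_ball (hO p hp)
  have hcb : ∀ p ∈ Z, ∀ x ∈ Metric.closedBall (c p) (r p), φ p x ∈ S.carrier ∧
      dist (φ p x) p < δ p := fun p hp x hx =>
    ⟨(hpar p hp).mem (hO p hp hx).1 (im_nonneg (hO p hp hx).2), (hφ p hp (mem_image_of_mem _ hx)).2⟩
  have hsep : ∀ p ∈ Z, ∀ p' ∈ Z, p ≠ p' → ∀ z, dist z p < δ p → cutoffAt p' (δ p') z = 0 := by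
    intro p hp p' hp' hne z hz
    refine cutoffAt_eq_zero (hδ p' hp') (not_lt.1 fun hz' => ?_)
    exact disjoint_left.1 (hUd hp hp' hne)
      (hδU p hp (Metric.mem_ball.2 (hz.trans (by linarith [hδ p hp])))) (hδU p' hp' hz')
  set K := S.carrier \ ⋃ p ∈ Z, V p with hKdef
  have hKc : IsCompact K := S.isCompact.diff (isOpen_biUnion hV)
  obtain ⟨ε, hε, hK⟩ := hKc.exists_pos_lt_norm
    (hq.continuousOn.mono (sdiff_subset.trans hS)) fun z hz hz0 => by
      have hzZ := (hZ z).2 ⟨hz.1, hz0⟩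
      exact hz.2 (mem_biUnion hzZ ((hVe z hzZ).subset (hpφ z hzZ)).2)
  -- a point of the surface either lies in one of the disks, or `q` is not small there
  have hcases : ∀ z ∈ S.carrier, z ∈ K ∨ ∃ p ∈ Z, z ∈ φ p '' Metric.ball (c p) (r p) := by
    intro z hz
    by_cases h : z ∈ ⋃ p ∈ Z, V p
    · obtain ⟨p, hp, hzp⟩ := mem_iUnion₂.1 h
      exact Or.inr ⟨p, hp, (hVe p hp).superset ⟨hz, hzp⟩⟩
    · exact Or.inl ⟨hz, h⟩
  have hγK : ∀ t, γ t ∈ K := fun t => by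
    refine (hcases _ (hγ.mem_carrier t)).resolve_right ?_
    rintro ⟨p, hp, x, hx, hxt⟩
    have hx' := hO p hp (Metric.ball_subset_closedBall hx)
    exact hx'.2.ne' (hγ.im_eq_zero (hc p hp) hx'.1 hx'.2.le hxt)
  have hsK : ∀ p ∈ Z, ∀ x ∈ Metric.sphere (c p) (r p), φ p x ∈ K := fun p hp x hx => by
    have hxb := Metric.sphere_subset_closedBall hx
    refine (hcases _ (hcb p hp x hxb).1).resolve_right ?_
    rintro ⟨p', hp', y, hy, hyx⟩
    have hyb := Metric.ball_subset_closedBall hy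
    by_cases hpp : p' = p
    · subst hpp
      have := (hpar p' hp).injOn ⟨(hO p' hp hyb).1, (im_nonneg (hO p' hp hyb).2)⟩
        ⟨(hO p' hp hxb).1, (im_nonneg (hO p' hp hxb).2)⟩ hyx
      subst this
      exact (Metric.mem_ball.1 hy).ne (Metric.mem_sphere.1 hx)
    · have h1 := hsep p hp p' hp' (Ne.symm hpp) _ (hcb p hp x hxb).2
      rw [← hyx, cutoffAt_eq_one (hδ p' hp') (hcb p' hp' y hyb).2] at h1
      exact one_ne_zero h1
  have hqa : ∀ z ∈ Ω, ContDiffAt ℝ ∞ q z := fun z hz => hq.contDiffAt (hΩ.mem_nhds hz)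
  have hβ : ∀ z ∈ Ω, ContinuousAt (fderiv ℝ q) z := fun z hz =>
    ((hqa z hz).fderiv_right (m := 0) (by simp)).continuousAt
  set α := fderiv ℝ fun y => cutoffInv ε (q y) with hαdef
  have hα : ∀ z ∈ Ω, ContinuousAt α z := fun z hz =>
    (((contDiff_cutoffInv hε).contDiffAt.comp z (hqa z hz)).fderiv_right (m := 0)
      (by simp)).continuousAt
  have hK0 : ∀ z ∈ K, ∀ u v, wedge (α z) (fderiv ℝ q z) u v = 0 := fun z hz =>
    wedge_fderiv_cutoffInv_eq_zero hε ((hqa z (hS hz.1)).differentiableAt (by simp)) (hK z hz)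
  have hαp : ∀ p ∈ Z, ∀ z ∈ Ω, ContinuousAt (fun z => cutoffAt p (δ p) z • α z) z :=
    fun p _ z hz => (continuous_cutoffAt p (δ p)).continuousAt.smul (hα z hz)
  have hwind : ∀ p ∈ Z, Λ.surfInt (fun z => cutoffAt p (δ p) z • α z) (fderiv ℝ q) =
      2 * Real.pi * Complex.I * (-2 * localIndex q S p) := fun p hp => by
    have hbi : Metric.ball (c p) (r p) ⊆ upperPlane := fun x hx =>
      (im_nonneg (hO p hp (Metric.ball_subset_closedBall hx)).2)
    rw [Λ.surfInt_eq_setIntegral (hαp p hp) hβ (S.atlas_isPositiveParam (hc p hp))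
      (isCompact_closedBall (c p) (r p)) (fun x hx => (hO p hp hx).1)
      (fun x hx => hS (hcb p hp x hx).1) Metric.isOpen_ball.measurableSet
      Metric.ball_subset_closedBall hbi]
    · rw [hW p hp (O p) (φ p) (c p) (r p) (S.atlas_isPositiveParam (hc p hp)) (hr p hp) (hO p hp)
        (hpφ p hp) ((hφ p hp).trans inter_subset_left), ← mul_assoc (-2 : ℂ),
        show (-2 : ℂ) * -(1 / 2) = 1 by norm_num, one_mul,
        windingNumber_circleMap (hpar p hp) hΩ hq hε (hr p hp) (fun x hx => (hO p hp hx).1)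
          (fun x hx => hS (hcb p hp x hx).1) (fun x hx => (hK _ (hsK p hp x hx)).le)]
      refine setIntegral_congr_fun Metric.isOpen_ball.measurableSet fun x hx => ?_
      simp only [pullWedge, wedge_smul_left]
      rw [cutoffAt_eq_one (hδ p hp) (hcb p hp x (Metric.ball_subset_closedBall hx)).2]
      simp [hαdef]
    · intro z hz hzp u v
      rw [wedge_smul_left]
      rcases hcases z hz with h | ⟨p', hp', y, hy, rfl⟩
      · rw [hK0 z h, mul_zero]
      · have hne : p' ≠ p := by
          rintro rfl
          exact hzp (mem_image_of_mem _ hy)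
        rw [hsep p' hp' p hp hne _ (hcb p' hp' y (Metric.ball_subset_closedBall hy)).2]
        simp
  have hsum := Λ.surfInt_eq_sum Z (α' := α) hαp hβ (fun z hz u v => by
    simp only [wedge_smul_left]
    rcases hcases z hz with h | ⟨p, hp, y, hy, rfl⟩
    · simp [hK0 z h]
    · have hd := (hcb p hp y (Metric.ball_subset_closedBall hy)).2
      rw [Finset.sum_eq_single_of_mem p hp fun p' hp' hne => by
        rw [hsep p hp p' hp' (Ne.symm hne) _ hd]; simp]
      rw [cutoffAt_eq_one (hδ p hp) hd]
      simp)
  rw [Finset.sum_congr rfl hwind, ← hγ.windingNumber_eq_surfInt hΩ hS Λ hq hε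
    (fun t => (hK _ (hγK t)).le), ← Finset.mul_sum, ← Finset.mul_sum] at hsum
  exact mul_left_cancel₀ Complex.two_pi_I_ne_zero hsum

end OrientedSurface

/-! ### Smoothness of the invariant determinant -/

section Smooth

variable {Ω : Set (ℂ × ℂ)} {f g : ℂ × ℂ → ℂ} {ρ : ℂ × ℂ → ℝ}

theorem contDiffOn_fderiv_apply (hΩ : IsOpen Ω) (hf : ContDiffOn ℝ ∞ f Ω) (v : ℂ × ℂ) :
    ContDiffOn ℝ ∞ (fun Z => fderiv ℝ f Z v) Ω := fun z hz =>
  (((hf.contDiffAt (hΩ.mem_nhds hz)).fderiv_right (m := ∞) (by simp)).clm_apply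
    contDiffAt_const).contDiffWithinAt

theorem contDiffOn_dz (hΩ : IsOpen Ω) (hf : ContDiffOn ℝ ∞ f Ω) : ContDiffOn ℝ ∞ (dz f) Ω :=
  contDiffOn_const.mul ((contDiffOn_fderiv_apply hΩ hf _).sub
    (contDiffOn_const.mul (contDiffOn_fderiv_apply hΩ hf _)))

theorem contDiffOn_dw (hΩ : IsOpen Ω) (hf : ContDiffOn ℝ ∞ f Ω) : ContDiffOn ℝ ∞ (dw f) Ω :=
  contDiffOn_const.mul ((contDiffOn_fderiv_apply hΩ hf _).sub
    (contDiffOn_const.mul (contDiffOn_fderiv_apply hΩ hf _)))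

theorem contDiffOn_dzbar (hΩ : IsOpen Ω) (hf : ContDiffOn ℝ ∞ f Ω) :
    ContDiffOn ℝ ∞ (dzbar f) Ω :=
  contDiffOn_const.mul ((contDiffOn_fderiv_apply hΩ hf _).add
    (contDiffOn_const.mul (contDiffOn_fderiv_apply hΩ hf _)))

theorem contDiffOn_dwbar (hΩ : IsOpen Ω) (hf : ContDiffOn ℝ ∞ f Ω) :
    ContDiffOn ℝ ∞ (dwbar f) Ω :=
  contDiffOn_const.mul ((contDiffOn_fderiv_apply hΩ hf _).add
    (contDiffOn_const.mul (contDiffOn_fderiv_apply hΩ hf _)))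

theorem contDiffOn_toCplx (hρ : ContDiffOn ℝ ∞ ρ Ω) : ContDiffOn ℝ ∞ (toCplx ρ) Ω :=
  Complex.ofRealCLM.contDiff.comp_contDiffOn hρ

theorem contDiffOn_Lbar (hΩ : IsOpen Ω) (hρ : ContDiffOn ℝ ∞ ρ Ω) (hf : ContDiffOn ℝ ∞ f Ω) :
    ContDiffOn ℝ ∞ (Lbar ρ f) Ω :=
  ((contDiffOn_dwbar hΩ (contDiffOn_toCplx hρ)).neg.mul (contDiffOn_dzbar hΩ hf)).add
    ((contDiffOn_dzbar hΩ (contDiffOn_toCplx hρ)).mul (contDiffOn_dwbar hΩ hf))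

theorem contDiffOn_iterate_Lbar (hΩ : IsOpen Ω) (hρ : ContDiffOn ℝ ∞ ρ Ω)
    (hf : ContDiffOn ℝ ∞ f Ω) (n : ℕ) : ContDiffOn ℝ ∞ ((Lbar ρ)^[n] f) Ω := by
  induction n with
  | zero => exact hf
  | succ n ih => rw [Function.iterate_succ_apply']; exact contDiffOn_Lbar hΩ hρ ih

theorem contDiffOn_colA3 (hΩ : IsOpen Ω) (hρ : ContDiffOn ℝ ∞ ρ Ω) (i : Fin 5) :
    ContDiffOn ℝ ∞ (colA3 ρ i) Ω := by
  have hz : ContDiffOn ℝ ∞ (rhoz ρ) Ω := contDiffOn_dz hΩ (contDiffOn_toCplx hρ)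
  have hw : ContDiffOn ℝ ∞ (rhow ρ) Ω := contDiffOn_dw hΩ (contDiffOn_toCplx hρ)
  fin_cases i
  · exact hw.pow 3
  · exact hz.mul (hw.pow 2)
  · exact (hz.pow 2).mul hw
  · exact hz.pow 3
  · exact (((contDiffOn_dz hΩ hz).mul (hw.pow 2)).sub
      (((contDiffOn_const.mul (contDiffOn_dz hΩ hw)).mul hz).mul hw)).add
      ((contDiffOn_dw hΩ hw).mul (hz.pow 2))

theorem contDiffOn_umbilicalDet (hΩ : IsOpen Ω) (hρ : ContDiffOn ℝ ∞ ρ Ω) :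
    ContDiffOn ℝ ∞ (umbilicalDet ρ) Ω := by
  have h : umbilicalDet ρ = fun Z => ∑ σ : Equiv.Perm (Fin 5),
      ((Equiv.Perm.sign σ : ℤ) : ℂ) * ∏ i, A3 ρ Z (σ i) i := by
    ext Z
    exact Matrix.det_apply' _
  rw [h]
  refine ContDiffOn.sum fun σ _ => contDiffOn_const.mul (contDiffOn_prod fun i _ => ?_)
  exact contDiffOn_iterate_Lbar hΩ hρ (contDiffOn_colA3 hΩ hρ _) _

end Smooth

/-! ### Transversal zeros are isolated -/

/-- The differential of a function that is constant on `S` near `p` kills the tangent space. -/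
theorem tangentSpan_le_ker {F : Type*} [NormedAddCommGroup F] [NormedSpace ℝ F]
    {S : Set (ℂ × ℂ)} {p : ℂ × ℂ} {f : ℂ × ℂ → F} {f' : ℂ × ℂ →L[ℝ] F} (hf : HasFDerivAt f f' p)
    {a : F} (h : f =ᶠ[𝓝[S] p] fun _ => a) (hp : f p = a) :
    tangentSpan S p ≤ LinearMap.ker (f' : ℂ × ℂ →ₗ[ℝ] F) := by
  refine Submodule.span_le.2 fun v hv => ?_
  have h0 : HasFDerivWithinAt f (0 : ℂ × ℂ →L[ℝ] F) S p :=
    (hasFDerivWithinAt_const a p S).congr_of_eventuallyEq h hp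
  exact hf.hasFDerivWithinAt.unique_on h0 hv

theorem IsLocalParam.tangentSpan_le_range {S : Set (ℂ × ℂ)} {O : Set ℂ} {φ : ℂ → ℂ × ℂ}
    (h : IsLocalParam S O φ) {x : ℂ} (hx : x ∈ O) (hxi : 0 ≤ x.im) :
    tangentSpan S (φ x) ≤ LinearMap.range (fderiv ℝ φ x : ℂ →ₗ[ℝ] ℂ × ℂ) := by
  obtain ⟨l, hl, hl'⟩ := exists_local_leftInverse (h.contDiffAt hx) (h.immersion x hx)
  have hlx : l (φ x) = x := hl.self_of_nhds
  have hd1 := (hl'.self_of_nhds.differentiableAt one_ne_zero).hasFDerivAt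
  have hd2 : HasFDerivAt φ (fderiv ℝ φ x) (l (φ x)) := by
    rw [hlx]; exact (h.differentiableAt hx).hasFDerivAt
  have hd := (hasFDerivAt_id (φ x)).sub (hd2.comp (φ x) hd1)
  refine (tangentSpan_le_ker hd (a := 0) ?_ (by simp [hlx])).trans ?_
  · filter_upwards [h.eventually_mem_image hx hxi hl] with z hz
    obtain ⟨y, ⟨hy, -⟩, -, rfl⟩ := hz
    have : l (φ y) = y := hy
    simp [this]
  · intro v hv
    have hv' : v - fderiv ℝ φ x (fderiv ℝ l (φ x) v) = 0 := hv
    exact ⟨fderiv ℝ l (φ x) v, (sub_eq_zero.1 hv').symm⟩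

/-- A surface that meets a curve transversally within a hypersurface, meets it in isolated
points: by a dimension count the tangent spaces intersect trivially, hence the equations of the
curve have injective differential along the surface. -/
theorem IsLocalParam.eventually_eq_of_transversal {S U : Set (ℂ × ℂ)} {O : Set ℂ}
    {φ : ℂ → ℂ × ℂ} (h : IsLocalParam S O φ) {x : ℂ} (hx : x ∈ O) (hxi : 0 ≤ x.im)
    (hU : IsSubmanifoldAt ∞ 1 U (φ x)) (τ : ℂ × ℂ →ₗ[ℝ] ℝ)
    (htr : tangentSpan S (φ x) ⊔ tangentSpan U (φ x) = LinearMap.ker τ) :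
    ∀ᶠ z in 𝓝[S] (φ x), z ∈ U → z = φ x := by
  obtain ⟨hpU, c, hc, V, g, hV, hpV, hg, hgs, hUV⟩ := hU
  have hc3 : c = 3 := by omega
  subst hc3
  have hgd : HasFDerivAt g (fderiv ℝ g (φ x)) (φ x) :=
    ((hg.contDiffAt (hV.mem_nhds hpV)).differentiableAt (by simp)).hasFDerivAt
  have hg0 : g (φ x) = 0 := (hUV.subset ⟨hpU, hpV⟩).2
  set A := LinearMap.range (fderiv ℝ φ x : ℂ →ₗ[ℝ] ℂ × ℂ) with hA
  set B := LinearMap.ker (fderiv ℝ g (φ x) : ℂ × ℂ →ₗ[ℝ] Fin 3 → ℝ) with hB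
  have hUB : tangentSpan U (φ x) ≤ B := tangentSpan_le_ker hgd (a := 0) (by
    filter_upwards [mem_nhdsWithin_of_mem_nhds (hV.mem_nhds hpV), self_mem_nhdsWithin] with z hz hzU
    exact (hUV.subset ⟨hzU, hz⟩).2) hg0
  have hE : Module.finrank ℝ (ℂ × ℂ) = 4 := by
    rw [Module.finrank_prod, Complex.finrank_real_complex]
  have hAd : Module.finrank ℝ A ≤ 2 := by
    rw [← Complex.finrank_real_complex]
    exact LinearMap.finrank_range_le _
  have hBd : Module.finrank ℝ B = 1 := by
    have h1 := LinearMap.finrank_range_add_finrank_ker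
      (fderiv ℝ g (φ x) : ℂ × ℂ →ₗ[ℝ] Fin 3 → ℝ)
    rw [LinearMap.range_eq_top.2 (hgs _ hpV), finrank_top, hE, Module.finrank_fin_fun] at h1
    exact Nat.add_left_cancel h1
  -- the tangent space of the hypersurface has dimension at least `4 - 1`
  have hTd : 3 ≤ Module.finrank ℝ (LinearMap.ker τ) := by
    have h1 := LinearMap.finrank_range_add_finrank_ker τ
    have h2 := (LinearMap.range τ).finrank_le
    rw [Module.finrank_self] at h2
    omega
  have hle : LinearMap.ker τ ≤ A ⊔ B :=
    htr ▸ sup_le_sup (h.tangentSpan_le_range hx hxi) hUB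
  have hAB : A ⊓ B = ⊥ := by
    have h1 := Submodule.finrank_sup_add_finrank_inf_eq A B
    have h2 := Submodule.finrank_mono hle
    rw [← Submodule.finrank_eq_zero (R := ℝ)]
    omega
  have hcomp := hgd.comp x (h.differentiableAt hx).hasFDerivAt
  have hker : LinearMap.ker ((fderiv ℝ g (φ x)).comp (fderiv ℝ φ x) : ℂ →ₗ[ℝ] Fin 3 → ℝ) = ⊥ := by
    refine LinearMap.ker_eq_bot'.2 fun v hv => ?_
    have h1 : fderiv ℝ φ x v ∈ A ⊓ B := ⟨⟨v, rfl⟩, hv⟩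
    rw [hAB, Submodule.mem_bot] at h1
    exact h.immersion x hx (h1.trans (map_zero _).symm)
  obtain ⟨k, -, hk⟩ := LinearMap.exists_antilipschitzWith _ hker
  have hne := hcomp.eventually_ne (c := (0 : Fin 3 → ℝ)) ⟨k, hk⟩
  have hφV : ∀ᶠ y in 𝓝 x, φ y ∈ V := (h.differentiableAt hx).continuousAt.eventually
    (hV.mem_nhds hpV)
  filter_upwards [h.eventually_mem_image hx hxi ((eventually_nhdsWithin_iff.1 hne).and hφV)]
    with z hz hzU
  obtain ⟨y, ⟨⟨hy, hyV⟩, -⟩, -, rfl⟩ := hz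
  by_contra hyx
  exact hy (fun h0 => hyx (by rw [h0])) (hUV.subset ⟨hzU, hyV⟩).2

theorem IsCompact.finite_zeros {K : Set (ℂ × ℂ)} (hK : IsCompact K) {q : ℂ × ℂ → ℂ}
    (hq : ContinuousOn q K)
    (hiso : ∀ p ∈ K, q p = 0 → ∀ᶠ z in 𝓝[K] p, q z = 0 → z = p) :
    {z ∈ K | q z = 0}.Finite := by
  by_contra hinf
  obtain ⟨p, hp, hacc⟩ := Set.Infinite.exists_accPt_of_subset_isCompact hinf hK fun z hz => hz.1
  have hfr := accPt_iff_frequently.1 hacc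
  by_cases h0 : q p = 0
  · refine hfr ?_
    filter_upwards [eventually_nhdsWithin_iff.1 (hiso p hp h0)] with z hz hz'
    exact hz'.1 (hz hz'.2.1 hz'.2.2)
  · refine hfr ?_
    filter_upwards [eventually_nhdsWithin_iff.1 ((hq p hp).eventually_ne h0)] with z hz hz'
    exact hz hz'.2.1 hz'.2.2

end

theorem proposition4p3
    (M Ω : Set (ℂ × ℂ)) (ρ : ℂ × ℂ → ℝ)
    (hM : IsRealAnalyticHypersurface M)
    (hρ : IsDefiningFunction ρ Ω M)
    (hdim : ∀ p ∈ umbilicalSet ρ M, varietyDimAt (umbilicalSet ρ M) p ≤ 1)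
    (S : OrientedSurface) (hSM : S.carrier ⊆ M)
    (γ : ℝ → ℂ × ℂ) (hγ : S.IsOrientedBoundary γ)
    (hγU : ∀ t, γ t ∉ umbilicalSet ρ M)
    (htrans : ∀ p ∈ umbilicalSet ρ M ∩ S.carrier,
      p ∈ regularUmbilicalSet ρ M ∧
      tangentSpan S.carrier p ⊔ tangentSpan (umbilicalSet ρ M) p
        = LinearMap.ker (fderiv ℝ ρ p : ℂ × ℂ →ₗ[ℝ] ℝ)) :
    (regularUmbilicalSet ρ M ∩ S.carrier).Finite ∧
    (∀ p ∈ regularUmbilicalSet ρ M ∩ S.carrier,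
      IsLocalIndex (umbilicalDet ρ) S p (localIndex (umbilicalDet ρ) S p)) ∧
    windingNumber (umbilicalDet ρ) γ =
      -2 * ∑ᶠ p ∈ regularUmbilicalSet ρ M ∩ S.carrier, localIndex (umbilicalDet ρ) S p := by
  have hSΩ : S.carrier ⊆ Ω := fun z hz => by
    have := hSM hz
    rw [hρ.eq_zeroSet] at this
    exact this.1
  have hQ : ContDiffOn ℝ ∞ (umbilicalDet ρ) Ω := contDiffOn_umbilicalDet hρ.isOpen hρ.contDiffOn
  have hreg : regularUmbilicalSet ρ M ∩ S.carrier = {z ∈ S.carrier | umbilicalDet ρ z = 0} := by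
    ext z
    exact ⟨fun hz => ⟨hz.2, hz.1.1.2⟩,
      fun hz => ⟨(htrans z ⟨⟨hSM hz.1, hz.2⟩, hz.1⟩).1, hz.1⟩⟩
  have hiso : ∀ p ∈ S.carrier, umbilicalDet ρ p = 0 →
      ∀ᶠ z in nhdsWithin p S.carrier, umbilicalDet ρ z = 0 → z = p := by
    intro p hp h0
    obtain ⟨hpr, htr⟩ := htrans p ⟨⟨hSM hp, h0⟩, hp⟩
    obtain ⟨c, hc, x, hx, hxi, rfl⟩ := S.covers p hp
    filter_upwards [(S.isLocalParam c hc).eventually_eq_of_transversal hx hxi hpr _ htr,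
      self_mem_nhdsWithin] with z hz hzS hz0
    exact hz ⟨hSM hzS, hz0⟩
  have hγ0 : ∀ t, umbilicalDet ρ (γ t) ≠ 0 := fun t h0 =>
    hγU t ⟨hSM (hγ.mem_carrier t), h0⟩
  have hfin : (regularUmbilicalSet ρ M ∩ S.carrier).Finite := by
    rw [hreg]
    exact S.isCompact.finite_zeros (hQ.continuousOn.mono hSΩ) hiso
  have hmem : ∀ z, z ∈ hfin.toFinset ↔ z ∈ S.carrier ∧ umbilicalDet ρ z = 0 := fun z => by
    rw [Set.Finite.mem_toFinset, hreg]
    rfl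
  have hind : ∀ p ∈ regularUmbilicalSet ρ M ∩ S.carrier,
      IsLocalIndex (umbilicalDet ρ) S p (localIndex (umbilicalDet ρ) S p) := by
    intro p hp
    have hp0 : umbilicalDet ρ p = 0 := hp.1.1.2
    refine OrientedSurface.isLocalIndex_localIndex
      (OrientedSurface.exists_isLocalIndex hρ.isOpen hSΩ hQ hp.2 (fun hb => ?_) (hiso p hp.2 hp0))
    rw [← hγ.range_eq] at hb
    obtain ⟨t, rfl⟩ := hb
    exact hγ0 t hp0
  refine ⟨hfin, hind, ?_⟩
  rw [finsum_mem_eq_finite_toFinset_sum _ hfin]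
  exact hγ.windingNumber_eq_sum_localIndex hρ.isOpen hSΩ hQ hγ0 hfin.toFinset hmem
    fun p hp => hind p (hfin.mem_toFinset.1 hp)
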